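/- Let $d\ge 3$ be odd. Let $|\Omega\rangle=d^{-1/2}\sum_{j=1}^d|j,j\rangle\in\mathbb C^d\otimes\mathbb C^d$, and let $\rho_T=(\mathrm{id}\otimes T)(|\Omega\rangle\langle\Omega|)$ be the Jamiolkowski state of a linear map $T:M_d\to M_d$. Let $\mathcal S$ be the set of all $\rho_T$ with $T$ completely positive, trace preserving and unital, let $\mathcal U$ be the convex hull of the states $(1\otimes U)|\Omega\rangle\langle\Omega|(1\otimes U^\dagger)$ with $U\in U(d)$ (the mixtures of unitary channels), and for $\rho\in\mathcal S$ let $$\mathcal N_{\mathcal U}(\rho)=\inf\{\alpha_n : \rho=\alpha_p\sigma_p-\alpha_n\sigma_n,\ \alpha_p,\alpha_n\ge 0,\ \sigma_p,\sigma_n\in\mathcal U\}.$$ Let $G'$ be the commutant of $\{O\otimes O : O\in M_d \text{ real orthogonal}\}$; thus $\mathcal S\cap G'$ is the set of Jamiolkowski states of $O(d)$-covariant unital channels. Let $\mathbb F|k,l\rangle=|l,k\rangle$, $P_0=|\Omega\rangle\langle\Omega|$, $P_1=\tfrac12(1-\mathbb F)$, $P_2=\tfrac12(1+\mathbb F)-|\Omega\rangle\langle\Omega|$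 and $\rho_i=P_i/\mathrm{tr}\,P_i$. 1. $\mathcal S\cap G'=\{\sum_{i=0}^2 q_i\rho_i : q_i\ge 0,\ \sum_i q_i=1\}$; the coefficients $q_i$ are determined by $\rho$, and every $\rho\in\mathcal S\cap G'$ has a decomposition as in the definition of $\mathcal N_{\mathcal U}(\rho)$. 2. Let $\rho=\sum_i q_i\rho_i$ with $q_i\ge 0$ and $\sum_i q_i=1$, and suppose $\rho\notin\mathcal U$. Then $q_1>0$, and with $q:=q_0/q_1$: - if $q\le\frac1{d(d-1)}$, then $\mathcal N_{\mathcal U}(\rho)=\frac{d}{d-1}q_1-1$; - if $q>\frac1{d(d-1)}$, then $$\mathcal N_{\mathcal U}(\rho)=\frac1{d-2}\left(d-1+\Big(d+\frac2{d-2}\Big)q-2\,\frac{d-1}{d-2}\sqrt{q^2+\frac{d-2}{d-1}\,q}\right)q_1-1 .$$ 3. The Werner–Holevo channel $T(X)=(\mathrm{tr}[X]\,1-X^T)/(d-1)$ has Jamiolkowski state $\rho_1$, which lies in $(\mathcal S\cap G')\setminus\mathcal U$. For every $\rho\in\mathcal S\cap G'$ one has $\mathcal N_{\mathcal U}(\rho)\le\frac1{d-1}$,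 with equality if and only if $\rho=\rho_1$. -/

import Mathlib

open scoped ComplexOrder Kronecker

/-- Operators on `ℂ^d ⊗ ℂ^d`, as matrices indexed by pairs. -/
abbrev BipMat (d : ℕ) : Type := Matrix (Fin d × Fin d) (Fin d × Fin d) ℂ

/-- The ampliation `id ⊗ T`, acting on each `(i, j)` block of a block matrix by `T`. -/
def ampliation {d : ℕ} {κ : Type*}
    (T : Matrix (Fin d) (Fin d) ℂ →ₗ[ℂ] Matrix (Fin d) (Fin d) ℂ)
    (X : Matrix (κ × Fin d) (κ × Fin d) ℂ) : Matrix (κ × Fin d) (κ × Fin d) ℂ :=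
  Matrix.of fun p q => T (Matrix.of fun a b => X (p.1, a) (q.1, b)) p.2 q.2

/-- Complete positivity: every ampliation `id_n ⊗ T` preserves positive semidefiniteness. -/
def IsCompletelyPositive {d : ℕ}
    (T : Matrix (Fin d) (Fin d) ℂ →ₗ[ℂ] Matrix (Fin d) (Fin d) ℂ) : Prop :=
  ∀ (n : ℕ) (X : Matrix (Fin n × Fin d) (Fin n × Fin d) ℂ),
    X.PosSemidef → (ampliation T X).PosSemidef

/-- Unital (doubly stochastic) quantum channels. -/
structure IsUnitalChannel {d : ℕ}
    (T : Matrix (Fin d) (Fin d) ℂ →ₗ[ℂ] Matrix (Fin d) (Fin d) ℂ) : Prop where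
  completelyPositive : IsCompletelyPositive T
  tracePreserving : ∀ X, (T X).trace = X.trace
  unital : T 1 = 1

/-- The maximally entangled vector `Ω = d^(-1/2) ∑ⱼ |j,j⟩`. -/
noncomputable def omegaVec (d : ℕ) : Fin d × Fin d → ℂ :=
  fun p => if p.1 = p.2 then ((1 / Real.sqrt d : ℝ) : ℂ) else 0

/-- The maximally entangled state `|Ω⟩⟨Ω|`. -/
noncomputable def omegaState (d : ℕ) : BipMat d :=
  Matrix.vecMulVec (omegaVec d) (star (omegaVec d))

/-- The Jamiolkowski state `(id ⊗ T)(|Ω⟩⟨Ω|)`. -/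
noncomputable def jamiolkowski {d : ℕ}
    (T : Matrix (Fin d) (Fin d) ℂ →ₗ[ℂ] Matrix (Fin d) (Fin d) ℂ) : BipMat d :=
  ampliation T (omegaState d)

/-- The set `𝒮` of Jamiolkowski states of unital channels on `M_d`. -/
def unitalStates (d : ℕ) : Set (BipMat d) :=
  {ρ | ∃ T : Matrix (Fin d) (Fin d) ℂ →ₗ[ℂ] Matrix (Fin d) (Fin d) ℂ,
    IsUnitalChannel T ∧ jamiolkowski T = ρ}

/-- The set `𝒰` of Jamiolkowski states of mixtures of unitary channels. -/
def unitaryMixtures (d : ℕ) : Set (BipMat d) :=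
  convexHull ℝ {σ | ∃ U ∈ Matrix.unitaryGroup (Fin d) ℂ,
    σ = ((1 : Matrix (Fin d) (Fin d) ℂ) ⊗ₖ U) * omegaState d *
      ((1 : Matrix (Fin d) (Fin d) ℂ) ⊗ₖ U.conjTranspose)}

/-- The weights `αₙ` occurring in decompositions `ρ = αₚ σₚ - αₙ σₙ` with `αₚ, αₙ ≥ 0` and
`σₚ, σₙ ∈ 𝒰`. -/
def negativeWeights (d : ℕ) (ρ : BipMat d) : Set ℝ :=
  {αn | 0 ≤ αn ∧ ∃ αp : ℝ, 0 ≤ αp ∧ ∃ σp ∈ unitaryMixtures d, ∃ σn ∈ unitaryMixtures d,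
    ρ = αp • σp - αn • σn}

/-- The negativity `𝒩_𝒰(ρ)`. -/
noncomputable def negativity (d : ℕ) (ρ : BipMat d) : ℝ :=
  sInf (negativeWeights d ρ)

/-- The commutant `G'` of `G = {O ⊗ O : O real orthogonal}`. -/
def orthogonalCommutant (d : ℕ) : Set (BipMat d) :=
  {X | ∀ O ∈ Matrix.orthogonalGroup (Fin d) ℝ,
    X * (O.map Complex.ofReal ⊗ₖ O.map Complex.ofReal) =
      (O.map Complex.ofReal ⊗ₖ O.map Complex.ofReal) * X}

/-- The flip operator `|k,l⟩ ↦ |l,k⟩`. -/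
def flipOp (d : ℕ) : BipMat d :=
  Matrix.of fun p q => if p.1 = q.2 ∧ p.2 = q.1 then 1 else 0

/-- The minimal projections `P₀, P₁, P₂` of the commutant `G'`. -/
noncomputable def minimalProj (d : ℕ) : Fin 3 → BipMat d :=
  ![omegaState d,
    (1 / 2 : ℂ) • (1 - flipOp d),
    (1 / 2 : ℂ) • (1 + flipOp d) - omegaState d]

/-- The normalized density matrices `ρᵢ = Pᵢ / tr Pᵢ`. -/
noncomputable def extremeState (d : ℕ) (i : Fin 3) : BipMat d :=
  (minimalProj d i).trace⁻¹ • minimalProj d i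

/-- The convex combination `∑ᵢ qᵢ ρᵢ`. -/
noncomputable def covariantState (d : ℕ) (q : Fin 3 → ℝ) : BipMat d :=
  ∑ i, q i • extremeState d i

/-- The Werner–Holevo channel `X ↦ (tr X · 1 - Xᵀ) / (d - 1)`. -/
noncomputable def wernerHolevo (d : ℕ) :
    Matrix (Fin d) (Fin d) ℂ →ₗ[ℂ] Matrix (Fin d) (Fin d) ℂ where
  toFun X := ((d : ℂ) - 1)⁻¹ • (X.trace • (1 : Matrix (Fin d) (Fin d) ℂ) - X.transpose)
  map_add' X Y := by
    rw [Matrix.trace_add, Matrix.transpose_add, ← smul_add, add_smul]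
    congr 1
    abel
  map_smul' c X := by
    rw [Matrix.trace_smul, Matrix.transpose_smul, RingHom.id_apply, smul_comm c, smul_sub c,
      smul_assoc]

/-!
Averaging over `O ⊗ O` with `O` real orthogonal preserves mixtures of unitary channels and the
weights `pᵢ = tr (Pᵢ σ)`, and projects onto the states with coordinates `pᵢ`. So everything is
decided by the region of weights `(p₀, p₁)` of unitary channels, and for a unitary `U` these are
`p₀ = |tr U|² / d²` and `p₁ = ‖U - Uᵀ‖² / (4 d)` in the Frobenius norm.

For odd `d` the antisymmetric matrix `U - Uᵀ` is singular, so there is a rank-one orthogonal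
projection `P` on which `U` agrees with its symmetric part `S`, whence `‖S P‖ = 1`. Splitting
`tr U = tr S` along `P` and `1 - P` and applying the weighted Cauchy–Schwarz inequality bounds a
linear combination of `p₀` and `p₁` for every value of the weight `c ≥ 0`. These lines support the
region: the one with parameter `c ∈ [0, 1]` is touched by direct sums of `1` with planar rotations
of cosine `c`, and the line `c = 0` also at `p₀ = 0`.

A state `ρ` outside the region is `a σ - (a - 1) τ`, where `τ` has weights `(0, 0, 1)` and `σ` is
the point at which the ray from `τ` to `ρ` leaves the region. The linear functional that vanishes at
`τ` and is `1` on the line supporting the region at `σ` takes values in `[0, 1]` on mixtures of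
unitary channels, so it certifies that the negative weight `a - 1` is optimal.
-/

section ConvexGeometry

theorem convexHull_eq_image_stdSimplex_prod_pi {E : Type*} [AddCommGroup E] [Module ℝ E]
    [FiniteDimensional ℝ E] {s : Set E} (hs : s.Nonempty) :
    convexHull ℝ s =
      (fun p : (Fin (Module.finrank ℝ E + 1) → ℝ) × (Fin (Module.finrank ℝ E + 1) → E) =>
        ∑ i, p.1 i • p.2 i) '' (stdSimplex ℝ _ ×ˢ Set.univ.pi fun _ => s) := by
  obtain ⟨x₀, hx₀⟩ := hs
  apply Set.Subset.antisymm
  · intro x hx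
    obtain ⟨ι, hι, z, w, hz, hind, hw, hsum, rfl⟩ := eq_pos_convex_span_of_mem_convexHull hx
    have hcard : Fintype.card ι ≤ Fintype.card (Fin (Module.finrank ℝ E + 1)) := by
      rw [Fintype.card_fin]
      exact hind.card_le_finrank_succ.trans (Nat.succ_le_succ (Submodule.finrank_le _))
    obtain ⟨e⟩ := Function.Embedding.nonempty_of_card_le hcard
    have extend_weights {i} (hi : i ∉ Set.range e) : Function.extend e w 0 i = 0 :=
      Function.extend_apply' _ _ _ hi
    refine ⟨(Function.extend e w 0, Function.extend e z fun _ => x₀), ⟨⟨fun i => ?_, ?_⟩,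
      fun i _ => ?_⟩,
      (Fintype.sum_of_injective e e.injective _ _ (fun i hi => ?_) fun i => ?_).symm⟩
    · exact Function.extend_nonneg (f := e) (g := w) (fun j => (hw j).le) le_rfl i
    · rw [← hsum]
      exact (Fintype.sum_of_injective e e.injective _ _ (fun i => extend_weights) fun i =>
        (e.injective.extend_apply _ _ _).symm).symm
    · by_cases hi : i ∈ Set.range e
      · obtain ⟨j, rfl⟩ := hi
        simpa only [e.injective.extend_apply] using hz ⟨j, rfl⟩
      · simpa only [Function.extend_apply' _ _ _ hi] using hx₀
    · simp only [extend_weights hi, zero_smul]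
    · simp only [e.injective.extend_apply]
  · rintro _ ⟨⟨w, z⟩, ⟨⟨hw, hsum⟩, hz⟩, rfl⟩
    exact (convex_convexHull ℝ s).sum_mem (fun i _ => hw i) hsum
      fun i _ => subset_convexHull ℝ s (hz i trivial)

theorem isCompact_convexHull_of_finiteDimensional {E : Type*} [AddCommGroup E] [Module ℝ E]
    [TopologicalSpace E] [ContinuousAdd E] [ContinuousSMul ℝ E] [FiniteDimensional ℝ E]
    {s : Set E} (hs : IsCompact s) : IsCompact (convexHull ℝ s) := by
  rcases s.eq_empty_or_nonempty with rfl | hne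
  · simp
  rw [convexHull_eq_image_stdSimplex_prod_pi hne]
  exact ((isCompact_stdSimplex ℝ _).prod (isCompact_univ_pi fun _ => hs)).image (by fun_prop)

theorem exists_common_fixedPoint_of_strictConvexOn {E : Type*} [AddCommGroup E] [Module ℝ E]
    [TopologicalSpace E] {K : Set E} (hK : IsCompact K) (hne : K.Nonempty) {φ : E → ℝ}
    (hφ : StrictConvexOn ℝ K φ) (hcont : ContinuousOn φ K) :
    ∃ x ∈ K, ∀ f : E → E, Set.MapsTo f K K → (∀ y ∈ K, φ (f y) ≤ φ y) → f x = x := by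
  obtain ⟨x, hxK, hmin⟩ := hK.exists_isMinOn hne hcont
  refine ⟨x, hxK, fun f hf hle => hφ.eq_of_isMinOn ?_ hmin (hf hxK) hxK⟩
  exact fun y hy => (hle x hxK).trans (hmin hy)

end ConvexGeometry

section FrobeniusNorm

open scoped Matrix.Norms.Frobenius

variable {m n : Type*} [Fintype m] [Fintype n]

theorem frobenius_norm_sq (A : Matrix m n ℂ) : ‖A‖ ^ 2 = ∑ i, ∑ j, ‖A i j‖ ^ 2 := by
  rw [Matrix.frobenius_norm_def, ← Real.sqrt_eq_rpow, Real.sq_sqrt (by positivity)]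
  simp only [Real.rpow_two]

theorem frobenius_norm_sq_eq_trace (A : Matrix m n ℂ) :
    ((‖A‖ ^ 2 : ℝ) : ℂ) = (A * A.conjTranspose).trace := by
  rw [frobenius_norm_sq]
  simp [Matrix.trace, Matrix.mul_apply, Complex.mul_conj']

theorem frobenius_norm_add_sq_add_norm_sub_sq (A B : Matrix m n ℂ) :
    ‖A + B‖ ^ 2 + ‖A - B‖ ^ 2 = 2 * (‖A‖ ^ 2 + ‖B‖ ^ 2) := by
  simp only [frobenius_norm_sq, ← Finset.sum_add_distrib, Finset.mul_sum, Matrix.add_apply,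
    Matrix.sub_apply]
  refine Finset.sum_congr rfl fun i _ => Finset.sum_congr rfl fun j _ => ?_
  simpa only [sq] using parallelogram_law_with_norm ℝ (A i j) (B i j)

theorem strictConvexOn_frobenius_norm_sq {K : Set (Matrix m n ℂ)} (hK : Convex ℝ K) :
    StrictConvexOn ℝ K fun A => ‖A‖ ^ 2 := by
  refine ⟨hK, fun A _ B _ hAB a b ha hb hab => ?_⟩
  have defect : ‖a • A + b • B‖ ^ 2 = a * ‖A‖ ^ 2 + b * ‖B‖ ^ 2 - a * b * ‖A - B‖ ^ 2 := by
    obtain rfl : b = 1 - a := by linarith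
    simp only [frobenius_norm_sq, Finset.mul_sum, ← Finset.sum_add_distrib,
      ← Finset.sum_sub_distrib, Matrix.add_apply, Matrix.sub_apply, Matrix.smul_apply]
    refine Finset.sum_congr rfl fun i _ => Finset.sum_congr rfl fun j _ => ?_
    simp only [← Complex.normSq_eq_norm_sq, Complex.normSq_apply, Complex.add_re, Complex.add_im,
      Complex.sub_re, Complex.sub_im, Complex.smul_re, Complex.smul_im, smul_eq_mul]
    ring
  have hpos : 0 < ‖A - B‖ := norm_pos_iff.mpr (sub_ne_zero.mpr hAB)
  simp only [defect, smul_eq_mul]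
  exact sub_lt_self _ (by positivity)

theorem norm_trace_mul_le_frobenius_norm_mul (A : Matrix m n ℂ) (B : Matrix n m ℂ) :
    ‖(A * B).trace‖ ≤ ‖A‖ * ‖B‖ := by
  have cauchySchwarz := Finset.sum_mul_sq_le_sq_mul_sq (Finset.univ : Finset (m × n))
    (fun p => ‖A p.1 p.2‖) fun p => ‖B.transpose p.1 p.2‖
  simp only [Fintype.sum_prod_type, ← frobenius_norm_sq, Matrix.frobenius_norm_transpose,
    ← mul_pow] at cauchySchwarz
  calc ‖(A * B).trace‖ ≤ ∑ i, ∑ j, ‖A i j‖ * ‖B.transpose i j‖ := by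
        refine (norm_sum_le _ _).trans (Finset.sum_le_sum fun i _ => ?_)
        refine (norm_sum_le _ _).trans_eq (Finset.sum_congr rfl fun j _ => norm_mul _ _)
    _ ≤ ‖A‖ * ‖B‖ := abs_le_of_sq_le_sq' cauchySchwarz (by positivity) |>.2

variable [DecidableEq n]

theorem frobenius_norm_unitary_mul {U : Matrix n n ℂ} (hU : U ∈ Matrix.unitaryGroup n ℂ)
    (A : Matrix n m ℂ) : ‖U * A‖ = ‖A‖ := by
  have hU' : U.conjTranspose * U = 1 := Matrix.mem_unitaryGroup_iff'.mp hU
  have h : ‖U * A‖ ^ 2 = ‖A‖ ^ 2 := by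
    rw [← Complex.ofReal_inj, frobenius_norm_sq_eq_trace, frobenius_norm_sq_eq_trace,
      Matrix.trace_mul_comm, Matrix.trace_mul_comm A, Matrix.conjTranspose_mul, Matrix.mul_assoc,
      ← Matrix.mul_assoc _ U, hU', Matrix.one_mul]
  exact (pow_left_inj₀ (norm_nonneg _) (norm_nonneg _) two_ne_zero).mp h

theorem frobenius_norm_mul_unitary {U : Matrix n n ℂ} (hU : U ∈ Matrix.unitaryGroup n ℂ)
    (A : Matrix m n ℂ) : ‖A * U‖ = ‖A‖ := by
  rw [← Matrix.frobenius_norm_conjTranspose, Matrix.conjTranspose_mul,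
    ← Matrix.star_eq_conjTranspose U, frobenius_norm_unitary_mul (Unitary.star_mem hU),
    Matrix.frobenius_norm_conjTranspose]

theorem frobenius_norm_sq_of_mem_unitaryGroup {U : Matrix n n ℂ}
    (hU : U ∈ Matrix.unitaryGroup n ℂ) : ‖U‖ ^ 2 = Fintype.card n := by
  have h := frobenius_norm_sq_eq_trace U
  rw [← Matrix.star_eq_conjTranspose, Matrix.mem_unitaryGroup_iff.mp hU, Matrix.trace_one] at h
  exact_mod_cast h

theorem frobenius_norm_sq_of_isStarProjection {P : Matrix n n ℂ} (hP : IsStarProjection P) :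
    ((‖P‖ ^ 2 : ℝ) : ℂ) = P.trace := by
  rw [frobenius_norm_sq_eq_trace, ← Matrix.star_eq_conjTranspose,
    hP.isSelfAdjoint.star_eq, hP.isIdempotentElem.eq]

theorem frobenius_norm_mul_sq_add_norm_mul_one_sub_sq {P : Matrix n n ℂ}
    (hP : IsStarProjection P) (A : Matrix m n ℂ) :
    ‖A * P‖ ^ 2 + ‖A * (1 - P)‖ ^ 2 = ‖A‖ ^ 2 := by
  have mul_projection {Q : Matrix n n ℂ} (hQ : IsStarProjection Q) :
      ((‖A * Q‖ ^ 2 : ℝ) : ℂ) = (A * Q * A.conjTranspose).trace := by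
    rw [frobenius_norm_sq_eq_trace, Matrix.conjTranspose_mul, ← Matrix.mul_assoc,
      Matrix.mul_assoc A, ← Matrix.star_eq_conjTranspose Q, hQ.isSelfAdjoint.star_eq,
      hQ.isIdempotentElem.eq]
  rw [← Complex.ofReal_inj, Complex.ofReal_add, mul_projection hP, mul_projection hP.one_sub,
    frobenius_norm_sq_eq_trace, ← Matrix.trace_add, ← Matrix.add_mul, ← Matrix.mul_add,
    add_sub_cancel, Matrix.mul_one]

theorem mul_norm_trace_sq_le {P S : Matrix n n ℂ} (hP : IsStarProjection P) (htr : P.trace = 1)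
    {c : ℝ} (hc : 0 ≤ c) :
    c * ‖S.trace‖ ^ 2 ≤
      (1 + (Fintype.card n - 1) * c) * (c * ‖S * P‖ ^ 2 + ‖S * (1 - P)‖ ^ 2) := by
  have norm_sq_P : ‖P‖ ^ 2 = 1 := by
    exact_mod_cast (frobenius_norm_sq_of_isStarProjection hP).trans htr
  have norm_sq_compl : ‖1 - P‖ ^ 2 = Fintype.card n - 1 := by
    have h := frobenius_norm_sq_of_isStarProjection hP.one_sub
    rw [Matrix.trace_sub, htr, Matrix.trace_one] at h
    exact_mod_cast h
  have trace_le : ‖S.trace‖ ≤ ‖S * P‖ * ‖P‖ + ‖S * (1 - P)‖ * ‖1 - P‖ := by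
    have split : S.trace = (S * P * P).trace + (S * (1 - P) * (1 - P)).trace := by
      rw [mul_assoc, mul_assoc, hP.isIdempotentElem.eq, hP.one_sub.isIdempotentElem.eq,
        ← Matrix.trace_add, ← mul_add, add_sub_cancel, mul_one]
    rw [split]
    exact (norm_add_le _ _).trans (add_le_add (norm_trace_mul_le_frobenius_norm_mul _ _)
      (norm_trace_mul_le_frobenius_norm_mul _ _))
  rw [← norm_sq_compl]
  calc c * ‖S.trace‖ ^ 2 ≤ c * (‖S * P‖ * ‖P‖ + ‖S * (1 - P)‖ * ‖1 - P‖) ^ 2 := by gcongr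
    _ ≤ (‖P‖ ^ 2 + ‖1 - P‖ ^ 2 * c) * (c * ‖S * P‖ ^ 2 + ‖S * (1 - P)‖ ^ 2) := by
      linarith [sq_nonneg (‖P‖ * ‖S * (1 - P)‖ - c * ‖S * P‖ * ‖1 - P‖)]
    _ = _ := by rw [norm_sq_P]

theorem exists_isStarProjection_mul_eq_zero {A : Matrix n n ℂ} (hA : A.det = 0) :
    ∃ P : Matrix n n ℂ, IsStarProjection P ∧ P.trace = 1 ∧ A * P = 0 := by
  obtain ⟨v, hv, hAv⟩ := Matrix.exists_mulVec_eq_zero_iff.mpr hA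
  have hvv : star v ⬝ᵥ v ≠ 0 := dotProduct_star_self_eq_zero.not.mpr hv
  have real_norm : star (star v ⬝ᵥ v) = star v ⬝ᵥ v := by
    rw [← Matrix.star_dotProduct_star, star_star]
  refine ⟨(star v ⬝ᵥ v)⁻¹ • Matrix.vecMulVec v (star v), ⟨?_, ?_⟩, ?_, ?_⟩
  · rw [IsIdempotentElem, Matrix.smul_mul, Matrix.mul_smul, Matrix.vecMulVec_mul_vecMulVec,
      Matrix.vecMulVec_smul, inv_smul_smul₀ hvv]
  · rw [IsSelfAdjoint, Matrix.star_eq_conjTranspose, Matrix.conjTranspose_smul,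
      Matrix.conjTranspose_vecMulVec, star_star, star_inv₀, real_norm]
  · rw [Matrix.trace_smul, Matrix.trace_vecMulVec, dotProduct_comm v, smul_eq_mul,
      inv_mul_cancel₀ hvv]
  · rw [Matrix.mul_smul, Matrix.mul_vecMulVec, hAv, Matrix.zero_vecMulVec, smul_zero]

theorem det_sub_transpose_eq_zero_of_odd {K : Type*} [Field K] [NeZero (2 : K)]
    (hodd : Odd (Fintype.card n)) (A : Matrix n n K) : (A - A.transpose).det = 0 := by
  have h := Matrix.det_transpose (A - A.transpose)
  rw [Matrix.transpose_sub, Matrix.transpose_transpose, ← neg_sub, Matrix.det_neg,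
    hodd.neg_one_pow, neg_one_mul, neg_eq_iff_add_eq_zero, ← two_mul] at h
  exact (mul_eq_zero.mp h).resolve_left two_ne_zero

theorem mul_norm_trace_sq_le_of_mem_unitaryGroup (hodd : Odd (Fintype.card n))
    {U : Matrix n n ℂ} (hU : U ∈ Matrix.unitaryGroup n ℂ) {c : ℝ} (hc : 0 ≤ c) :
    c * ‖U.trace‖ ^ 2 ≤ (1 + (Fintype.card n - 1) * c) *
      (Fintype.card n - 1 + c - ‖U - U.transpose‖ ^ 2 / 4) := by
  obtain ⟨P, hP, htr, hUP⟩ :=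
    exists_isStarProjection_mul_eq_zero (det_sub_transpose_eq_zero_of_odd hodd U)
  set S : Matrix n n ℂ := (1 / 2 : ℂ) • (U + U.transpose) with hS
  have trace_S : S.trace = U.trace := by
    rw [hS, Matrix.trace_smul, Matrix.trace_add, Matrix.trace_transpose, smul_eq_mul]
    ring
  have S_mul_P : S * P = U * P := by
    rw [sub_mul, sub_eq_zero] at hUP
    rw [hS, Matrix.smul_mul, add_mul, ← hUP]
    module
  have norm_sq_SP : ‖S * P‖ ^ 2 = 1 := by
    rw [S_mul_P, frobenius_norm_unitary_mul hU]
    exact_mod_cast (frobenius_norm_sq_of_isStarProjection hP).trans htr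
  have norm_sq_S : ‖S‖ ^ 2 = Fintype.card n - ‖U - U.transpose‖ ^ 2 / 4 := by
    have h := frobenius_norm_add_sq_add_norm_sub_sq U U.transpose
    rw [Matrix.frobenius_norm_transpose, frobenius_norm_sq_of_mem_unitaryGroup hU] at h
    rw [hS, norm_smul, mul_pow]
    norm_num
    linarith
  have norm_sq_compl := frobenius_norm_mul_sq_add_norm_mul_one_sub_sq hP S
  convert mul_norm_trace_sq_le (S := S) hP htr hc using 2
  · rw [trace_S]
  · rw [norm_sq_SP] at norm_sq_compl ⊢
    linarith

end FrobeniusNorm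

section MaximallyEntangledVector

variable {d : ℕ}

/-- The vector `(1 ⊗ A) Ω`: the correspondence between operators on `ℂ^d` and vectors of
`ℂ^d ⊗ ℂ^d`, normalized so that unitaries go to unit vectors. -/
noncomputable def entangledVec (A : Matrix (Fin d) (Fin d) ℂ) : Fin d × Fin d → ℂ :=
  ((1 : Matrix (Fin d) (Fin d) ℂ) ⊗ₖ A).mulVec (omegaVec d)

theorem entangledVec_one : entangledVec (1 : Matrix (Fin d) (Fin d) ℂ) = omegaVec d := by
  rw [entangledVec, Matrix.one_kronecker_one, Matrix.one_mulVec]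

theorem entangledVec_apply (A : Matrix (Fin d) (Fin d) ℂ) (p : Fin d × Fin d) :
    entangledVec A p = A p.2 p.1 * ((1 / Real.sqrt d : ℝ) : ℂ) := by
  simp [entangledVec, Matrix.mulVec, dotProduct, Fintype.sum_prod_type, omegaVec,
    Matrix.one_apply]

theorem entangledVec_sub (A B : Matrix (Fin d) (Fin d) ℂ) :
    entangledVec (A - B) = entangledVec A - entangledVec B := by
  ext p
  simp only [Pi.sub_apply, entangledVec_apply, Matrix.sub_apply, sub_mul]

theorem entangledVec_smul (c : ℂ) (A : Matrix (Fin d) (Fin d) ℂ) :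
    entangledVec (c • A) = c • entangledVec A := by
  rw [entangledVec, Matrix.kronecker_smul, Matrix.smul_mulVec, entangledVec]

theorem vecMulVec_entangledVec_apply (A B : Matrix (Fin d) (Fin d) ℂ) (p q : Fin d × Fin d) :
    Matrix.vecMulVec (entangledVec A) (star (entangledVec B)) p q =
      (d : ℂ)⁻¹ * (A p.2 p.1 * star (B q.2 q.1)) := by
  have normalization : ((1 / Real.sqrt d : ℝ) : ℂ) * ((1 / Real.sqrt d : ℝ) : ℂ) = (d : ℂ)⁻¹ := by
    rw [← Complex.ofReal_mul, div_mul_div_comm, Real.mul_self_sqrt (Nat.cast_nonneg d)]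
    simp
  have star_ofReal (x : ℝ) : star (x : ℂ) = x := Complex.conj_ofReal x
  rw [Matrix.vecMulVec_apply, Pi.star_apply, entangledVec_apply, entangledVec_apply, star_mul',
    star_ofReal, ← normalization]
  ring

theorem star_entangledVec_dotProduct_entangledVec (A B : Matrix (Fin d) (Fin d) ℂ) :
    star (entangledVec A) ⬝ᵥ entangledVec B = (d : ℂ)⁻¹ * (A.conjTranspose * B).trace := by
  rw [dotProduct_comm, ← Matrix.trace_vecMulVec]
  simp only [Matrix.trace, Matrix.diag_apply, vecMulVec_entangledVec_apply, Matrix.mul_apply,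
    Fintype.sum_prod_type, Finset.mul_sum, Matrix.conjTranspose_apply]
  exact Finset.sum_congr rfl fun i _ => Finset.sum_congr rfl fun j _ => by ring

theorem kronecker_mulVec_entangledVec (A B C : Matrix (Fin d) (Fin d) ℂ) :
    (A ⊗ₖ B).mulVec (entangledVec C) = entangledVec (B * C * A.transpose) := by
  ext p
  simp only [Matrix.mulVec, dotProduct, entangledVec_apply, Matrix.kroneckerMap_apply,
    Fintype.sum_prod_type, Matrix.mul_apply, Matrix.transpose_apply, Finset.sum_mul]
  exact Finset.sum_congr rfl fun i _ => Finset.sum_congr rfl fun j _ => by ring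

theorem omegaState_eq_vecMulVec :
    omegaState d = Matrix.vecMulVec (entangledVec 1) (star (entangledVec 1)) := by
  rw [entangledVec_one, omegaState]

theorem omegaState_apply (p q : Fin d × Fin d) :
    omegaState d p q = if p.1 = p.2 ∧ q.1 = q.2 then (d : ℂ)⁻¹ else 0 := by
  rw [omegaState_eq_vecMulVec, vecMulVec_entangledVec_apply]
  simp only [Matrix.one_apply, eq_comm (a := p.2), eq_comm (a := q.2)]
  split_ifs <;> simp_all

theorem conjTranspose_omegaState : (omegaState d).conjTranspose = omegaState d :=
  (Matrix.posSemidef_vecMulVec_self_star _).isHermitian.eq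

theorem star_omegaVec : star (omegaVec d) = omegaVec d := by
  ext p
  simp only [Pi.star_apply, omegaVec, apply_ite star, star_zero, Complex.star_def,
    Complex.conj_ofReal]

theorem star_omegaVec_dotProduct_self (hd : d ≠ 0) : star (omegaVec d) ⬝ᵥ omegaVec d = 1 := by
  rw [← entangledVec_one, star_entangledVec_dotProduct_entangledVec, Matrix.conjTranspose_one,
    mul_one, Matrix.trace_one, Fintype.card_fin, inv_mul_cancel₀ (Nat.cast_ne_zero.mpr hd)]

theorem omegaState_mul_omegaState (hd : d ≠ 0) : omegaState d * omegaState d = omegaState d := by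
  rw [omegaState, Matrix.vecMulVec_mul_vecMulVec, star_omegaVec_dotProduct_self hd, one_smul]

theorem trace_omegaState (hd : d ≠ 0) : (omegaState d).trace = 1 := by
  rw [omegaState, Matrix.trace_vecMulVec, dotProduct_comm, star_omegaVec_dotProduct_self hd]

end MaximallyEntangledVector

section Flip

variable {d : ℕ}

theorem flipOp_apply (p q : Fin d × Fin d) : flipOp d p q = if p = q.swap then 1 else 0 := by
  simp only [flipOp, Matrix.of_apply, Prod.ext_iff, Prod.fst_swap, Prod.snd_swap]

theorem conjTranspose_flipOp : (flipOp d).conjTranspose = flipOp d := by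
  ext p q
  simp only [Matrix.conjTranspose_apply, flipOp_apply, ← Prod.swap_inj (p := q), Prod.swap_swap,
    eq_comm (a := p), apply_ite star, star_one, star_zero]

theorem mul_flipOp_apply (X : BipMat d) (p q : Fin d × Fin d) :
    (X * flipOp d) p q = X p q.swap := by
  simp [Matrix.mul_apply, flipOp_apply]

theorem flipOp_mul_apply (X : BipMat d) (p q : Fin d × Fin d) :
    (flipOp d * X) p q = X p.swap q := by
  rw [← Matrix.conjTranspose_conjTranspose (flipOp d * X), Matrix.conjTranspose_mul,
    conjTranspose_flipOp, Matrix.conjTranspose_apply, mul_flipOp_apply,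
    Matrix.conjTranspose_apply, star_star]

theorem flipOp_mulVec_apply (v : Fin d × Fin d → ℂ) (p : Fin d × Fin d) :
    (flipOp d).mulVec v p = v p.swap := by
  simpa [Matrix.mulVec, dotProduct, Matrix.mul_apply] using
    flipOp_mul_apply (Matrix.of fun q _ => v q) p p

theorem flipOp_mulVec_entangledVec (A : Matrix (Fin d) (Fin d) ℂ) :
    (flipOp d).mulVec (entangledVec A) = entangledVec A.transpose := by
  ext p
  simp only [flipOp_mulVec_apply, entangledVec_apply, Prod.snd_swap, Prod.fst_swap,
    Matrix.transpose_apply]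

theorem flipOp_mul_flipOp : flipOp d * flipOp d = 1 := by
  ext p q
  simp only [flipOp_mul_apply, flipOp_apply, Prod.swap_inj, Matrix.one_apply]

theorem trace_flipOp : (flipOp d).trace = d := by
  simp only [Matrix.trace, Matrix.diag_apply, Fintype.sum_prod_type]
  simp [flipOp, ite_and]

theorem flipOp_mul_omegaState : flipOp d * omegaState d = omegaState d := by
  rw [omegaState_eq_vecMulVec, Matrix.mul_vecMulVec, flipOp_mulVec_entangledVec,
    Matrix.transpose_one]

theorem omegaState_mul_flipOp : omegaState d * flipOp d = omegaState d := by
  rw [← conjTranspose_omegaState, ← conjTranspose_flipOp, ← Matrix.conjTranspose_mul,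
    flipOp_mul_omegaState]

theorem kronecker_mul_flipOp (A B : Matrix (Fin d) (Fin d) ℂ) :
    (A ⊗ₖ B) * flipOp d = flipOp d * (B ⊗ₖ A) := by
  ext p q
  rw [mul_flipOp_apply, flipOp_mul_apply]
  simp [mul_comm]

end Flip

section MinimalProjections

variable {d : ℕ}

/-- The dimension of the range of `minimalProj d i`. -/
noncomputable def projRank (d : ℕ) : Fin 3 → ℝ :=
  ![1, d * (d - 1) / 2, d * (d + 1) / 2 - 1]

theorem projRank_pos (hd : 2 ≤ d) (i : Fin 3) : 0 < projRank d i := by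
  have hd' : (2 : ℝ) ≤ d := by exact_mod_cast hd
  fin_cases i <;> simp only [projRank, Fin.zero_eta, Fin.mk_one, Fin.reduceFinMk, Matrix.cons_val]
    <;> nlinarith

theorem trace_minimalProj (hd : d ≠ 0) (i : Fin 3) :
    (minimalProj d i).trace = (projRank d i : ℂ) := by
  fin_cases i
  · simp [minimalProj, projRank, trace_omegaState hd]
  all_goals
    simp only [minimalProj, projRank, Fin.mk_one, Fin.reduceFinMk, Matrix.cons_val,
      Matrix.trace_sub, Matrix.trace_smul, Matrix.trace_add, Matrix.trace_one, trace_flipOp,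
      trace_omegaState hd, Fintype.card_prod, Fintype.card_fin, smul_eq_mul]
    push_cast
    ring

theorem isHermitian_minimalProj (i : Fin 3) : (minimalProj d i).IsHermitian := by
  rw [Matrix.IsHermitian]
  fin_cases i <;> simp [minimalProj, conjTranspose_omegaState, conjTranspose_flipOp]

theorem completeOrthogonalIdempotents_minimalProj (hd : d ≠ 0) :
    CompleteOrthogonalIdempotents (minimalProj d) := by
  refine CompleteOrthogonalIdempotents.iff_ortho_complete.mpr ⟨fun i j hij => ?_, ?_⟩
  · fin_cases i <;> fin_cases j <;> first | exact absurd rfl hij | skip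
    all_goals
      simp only [minimalProj, Fin.reduceFinMk, Fin.mk_one, Fin.zero_eta, Matrix.cons_val,
        Matrix.smul_mul, Matrix.mul_smul, mul_sub, sub_mul, mul_add, add_mul, mul_one, one_mul,
        flipOp_mul_flipOp, flipOp_mul_omegaState, omegaState_mul_flipOp,
        omegaState_mul_omegaState hd]
      module
  · simp only [Fin.sum_univ_three, minimalProj, Matrix.cons_val]
    module

theorem posSemidef_minimalProj (hd : d ≠ 0) (i : Fin 3) : (minimalProj d i).PosSemidef := by
  have h := Matrix.posSemidef_conjTranspose_mul_self (minimalProj d i)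
  rwa [(isHermitian_minimalProj i).eq,
    ((completeOrthogonalIdempotents_minimalProj hd).idem i).eq] at h

theorem commute_minimalProj_kronecker {A : Matrix (Fin d) (Fin d) ℂ}
    (hA : A ∈ Matrix.orthogonalGroup (Fin d) ℂ) (i : Fin 3) :
    Commute (minimalProj d i) (A ⊗ₖ A) := by
  have commute_flip : Commute (flipOp d) (A ⊗ₖ A) := (kronecker_mul_flipOp A A).symm
  have commute_omega : Commute (omegaState d) (A ⊗ₖ A) := by
    have map_omega {B : Matrix (Fin d) (Fin d) ℂ} (hB : B * B.transpose = 1) :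
        (B ⊗ₖ B).mulVec (omegaVec d) = omegaVec d := by
      rw [← entangledVec_one, kronecker_mulVec_entangledVec, mul_one, hB]
    have hA' : A.transpose * A.transpose.transpose = 1 :=
      (Matrix.mem_orthogonalGroup_iff' (Fin d) ℂ).mp hA
    rw [commute_iff_eq, omegaState, star_omegaVec, Matrix.mul_vecMulVec, Matrix.vecMulVec_mul,
      map_omega ((Matrix.mem_orthogonalGroup_iff (Fin d) ℂ).mp hA), ← Matrix.mulVec_transpose,
      ← Matrix.kroneckerMap_transpose, map_omega hA']
  fin_cases i
  · exact commute_omega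
  · exact ((Commute.one_left _).sub_left commute_flip).smul_left _
  · exact (((Commute.one_left _).add_left commute_flip).smul_left _).sub_left commute_omega

end MinimalProjections

section CovariantStates

variable {d : ℕ}

/-- The weight `tr (Pᵢ X)` of an operator on the range of `Pᵢ`; on Hermitian operators the trace
is real. -/
noncomputable def projWeight (i : Fin 3) : BipMat d →ₗ[ℝ] ℝ where
  toFun X := (minimalProj d i * X).trace.re
  map_add' X Y := by simp [mul_add]
  map_smul' c X := by simp

theorem projWeight_apply (i : Fin 3) (X : BipMat d) :
    projWeight i X = (minimalProj d i * X).trace.re := rfl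

theorem ofReal_projWeight {X : BipMat d} (hX : X.IsHermitian) (i : Fin 3) :
    ((projWeight i X : ℝ) : ℂ) = (minimalProj d i * X).trace := by
  apply Complex.conj_eq_iff_re.mp
  rw [← Complex.star_def, ← Matrix.trace_conjTranspose, Matrix.conjTranspose_mul, hX.eq,
    (isHermitian_minimalProj i).eq, Matrix.trace_mul_comm]

theorem sum_projWeight (hd : d ≠ 0) (X : BipMat d) : ∑ i, projWeight i X = X.trace.re := by
  simp only [projWeight_apply]
  rw [← Complex.re_sum, ← Matrix.trace_sum, ← Finset.sum_mul,
    (completeOrthogonalIdempotents_minimalProj hd).complete, one_mul]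

theorem projWeight_nonneg (hd : d ≠ 0) {X : BipMat d} (hX : X.PosSemidef) (i : Fin 3) :
    0 ≤ projWeight i X := by
  have h := (hX.mul_mul_conjTranspose_same (minimalProj d i)).trace_nonneg
  rw [(isHermitian_minimalProj i).eq, Matrix.trace_mul_comm, ← mul_assoc,
    ((completeOrthogonalIdempotents_minimalProj hd).idem i).eq] at h
  exact (Complex.nonneg_iff.mp h).1

theorem projWeight_conj {W : BipMat d} (hW : W ∈ Matrix.unitaryGroup (Fin d × Fin d) ℂ)
    {i : Fin 3} (hcomm : Commute (minimalProj d i) W) (X : BipMat d) :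
    projWeight i (W * X * W.conjTranspose) = projWeight i X := by
  have hW' : W.conjTranspose * W = 1 := Matrix.mem_unitaryGroup_iff'.mp hW
  rw [projWeight_apply, projWeight_apply, ← mul_assoc, ← mul_assoc, hcomm.eq,
    Matrix.trace_mul_comm, ← mul_assoc, ← mul_assoc, hW', one_mul]

theorem trace_minimalProj_mul_sum_smul (hd : d ≠ 0) (x : Fin 3 → ℂ) (i : Fin 3) :
    (minimalProj d i * ∑ j, x j • minimalProj d j).trace = x i * projRank d i := by
  have hP := completeOrthogonalIdempotents_minimalProj hd
  rw [Finset.mul_sum, Finset.sum_eq_single i, Matrix.mul_smul, (hP.idem i).eq, Matrix.trace_smul,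
    trace_minimalProj hd, smul_eq_mul]
  · intro j _ hj
    rw [Matrix.mul_smul, hP.ortho hj.symm, smul_zero]
  · simp only [Finset.mem_univ, not_true_eq_false, false_implies]

theorem extremeState_eq_smul (hd : d ≠ 0) (i : Fin 3) :
    extremeState d i = (projRank d i)⁻¹ • minimalProj d i := by
  rw [extremeState, trace_minimalProj hd, ← Complex.ofReal_inv, Complex.coe_smul]

theorem covariantState_eq_sum (hd : d ≠ 0) (q : Fin 3 → ℝ) :
    covariantState d q = ∑ i, (q i / projRank d i) • minimalProj d i := by
  simp only [covariantState, extremeState_eq_smul hd, smul_smul, div_eq_mul_inv]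

theorem covariantState_add (p q : Fin 3 → ℝ) :
    covariantState d (p + q) = covariantState d p + covariantState d q := by
  simp [covariantState, add_smul, Finset.sum_add_distrib]

theorem covariantState_smul (c : ℝ) (q : Fin 3 → ℝ) :
    covariantState d (c • q) = c • covariantState d q := by
  simp [covariantState, mul_smul, Finset.smul_sum]

theorem projWeight_covariantState (hd : 2 ≤ d) (q : Fin 3 → ℝ) (i : Fin 3) :
    projWeight i (covariantState d q) = q i := by
  have hd0 : d ≠ 0 := by omega
  rw [projWeight_apply, covariantState_eq_sum hd0]
  simp only [← Complex.coe_smul]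
  rw [trace_minimalProj_mul_sum_smul hd0, ← Complex.ofReal_mul, Complex.ofReal_re,
    div_mul_cancel₀ _ (projRank_pos hd i).ne']

theorem covariantState_injective (hd : 2 ≤ d) : Function.Injective (covariantState d) :=
  fun q q' h => funext fun i => by
    rw [← projWeight_covariantState hd q i, h, projWeight_covariantState hd]

theorem posSemidef_covariantState (hd : 2 ≤ d) {q : Fin 3 → ℝ} (hq : ∀ i, 0 ≤ q i) :
    (covariantState d q).PosSemidef := by
  rw [covariantState_eq_sum (by omega)]
  refine Matrix.posSemidef_sum _ fun i _ => ?_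
  exact (posSemidef_minimalProj (by omega) i).smul (div_nonneg (hq i) (projRank_pos hd i).le)

end CovariantStates

section OrthogonalCommutant

variable {d : ℕ}

theorem map_ofReal_mem_orthogonalGroup {O : Matrix (Fin d) (Fin d) ℝ}
    (hO : O ∈ Matrix.orthogonalGroup (Fin d) ℝ) :
    O.map Complex.ofReal ∈ Matrix.orthogonalGroup (Fin d) ℂ := by
  rw [Matrix.mem_orthogonalGroup_iff] at hO ⊢
  have h := congrArg (Complex.ofRealHom.mapMatrix (m := Fin d)) hO
  rwa [map_mul, map_one] at h

theorem map_ofReal_mem_unitaryGroup {O : Matrix (Fin d) (Fin d) ℝ}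
    (hO : O ∈ Matrix.orthogonalGroup (Fin d) ℝ) :
    O.map Complex.ofReal ∈ Matrix.unitaryGroup (Fin d) ℂ := by
  have star_map : star (O.map Complex.ofReal) = (O.map Complex.ofReal).transpose := by
    ext i j
    simp
  rw [Matrix.mem_unitaryGroup_iff, star_map]
  exact (Matrix.mem_orthogonalGroup_iff _ _).mp (map_ofReal_mem_orthogonalGroup hO)

theorem orthogonalCommutant_eq_centralizer :
    orthogonalCommutant d =
      (Subalgebra.centralizer ℂ ((fun O : Matrix (Fin d) (Fin d) ℝ =>
        O.map Complex.ofReal ⊗ₖ O.map Complex.ofReal) '' Matrix.orthogonalGroup (Fin d) ℝ) :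
        Set (BipMat d)) := by
  ext X
  simp only [orthogonalCommutant, Set.mem_ofPred_eq, SetLike.mem_coe,
    Subalgebra.mem_centralizer_iff, Set.forall_mem_image, eq_comm]

theorem minimalProj_mem_orthogonalCommutant (i : Fin 3) :
    minimalProj d i ∈ orthogonalCommutant d :=
  fun _ hO => commute_minimalProj_kronecker (map_ofReal_mem_orthogonalGroup hO) i

theorem sum_smul_minimalProj_mem_orthogonalCommutant (x : Fin 3 → ℂ) :
    ∑ i, x i • minimalProj d i ∈ orthogonalCommutant d := by
  have h (i : Fin 3) := minimalProj_mem_orthogonalCommutant (d := d) i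
  rw [orthogonalCommutant_eq_centralizer] at h ⊢
  exact sum_mem fun i _ => SMulMemClass.smul_mem (x i) (h i)

theorem covariantState_mem_orthogonalCommutant (q : Fin 3 → ℝ) :
    covariantState d q ∈ orthogonalCommutant d := by
  simp only [covariantState, extremeState, ← Complex.coe_smul, smul_smul]
  exact sum_smul_minimalProj_mem_orthogonalCommutant _

theorem mul_apply_eq_of_mem_orthogonalCommutant {X : BipMat d} (hX : X ∈ orthogonalCommutant d)
    {ε : Fin d → ℝ} (hε : ∀ i, ε i * ε i = 1) (i j k l : Fin d) :
    (ε k * ε l : ℂ) * X (i, j) (k, l) = ε i * ε j * X (i, j) (k, l) := by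
  have hO : Matrix.diagonal ε ∈ Matrix.orthogonalGroup (Fin d) ℝ := by
    rw [Matrix.mem_orthogonalGroup_iff, Matrix.diagonal_transpose, Matrix.diagonal_mul_diagonal,
      funext hε, Matrix.diagonal_one]
  have h := congrFun₂ (hX _ hO) (i, j) (k, l)
  rwa [Matrix.diagonal_map Complex.ofReal_zero, Matrix.diagonal_kronecker_diagonal,
    Matrix.mul_diagonal, Matrix.diagonal_mul, mul_comm] at h

theorem apply_eq_zero_of_mem_orthogonalCommutant {X : BipMat d} (hX : X ∈ orthogonalCommutant d)
    {i j k l : Fin d} (h : ¬((i = j ∧ k = l) ∨ (i = k ∧ j = l) ∨ (i = l ∧ j = k))) :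
    X (i, j) (k, l) = 0 := by
  by_contra hne
  have sign_flip (a : Fin d) := mul_right_cancel₀ hne <|
    mul_apply_eq_of_mem_orthogonalCommutant hX (ε := fun b => if b = a then -1 else 1)
      (fun b => by split_ifs <;> norm_num) i j k l
  norm_cast at sign_flip
  have hi := sign_flip i
  have hj := sign_flip j
  have hk := sign_flip k
  grind

theorem apply_perm_of_mem_orthogonalCommutant {X : BipMat d} (hX : X ∈ orthogonalCommutant d)
    (π : Equiv.Perm (Fin d)) (i j k l : Fin d) :
    X (π i, π j) (π k, π l) = X (i, j) (k, l) := by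
  have hO : π.permMatrix ℝ ∈ Matrix.orthogonalGroup (Fin d) ℝ := by
    rw [Matrix.mem_orthogonalGroup_iff, Matrix.transpose_permMatrix, ← Matrix.permMatrix_mul,
      inv_mul_cancel, Matrix.permMatrix_one]
  have h := congrFun₂ (hX _ hO) (i, j) (π k, π l)
  simpa [Matrix.mul_apply, Fintype.sum_prod_type, PEquiv.toMatrix_apply, apply_ite Complex.ofReal,
    eq_comm] using h.symm

theorem one_sub_smul_vecMulVec_mem_orthogonalGroup {n R : Type*} [Fintype n] [DecidableEq n]
    [CommRing R] {v : n → R} {c : R} (h : c * (v ⬝ᵥ v) = 2) :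
    1 - c • Matrix.vecMulVec v v ∈ Matrix.orthogonalGroup n R := by
  have hsq : (c • Matrix.vecMulVec v v) * (c • Matrix.vecMulVec v v) =
      (2 : R) • c • Matrix.vecMulVec v v := by
    rw [Matrix.smul_mul, Matrix.mul_smul, Matrix.vecMulVec_mul_vecMulVec, Matrix.vecMulVec_smul,
      ← h, smul_smul, smul_smul, smul_smul]
    ring_nf
  rw [Matrix.mem_orthogonalGroup_iff, Matrix.transpose_sub, Matrix.transpose_one,
    Matrix.transpose_smul, Matrix.transpose_vecMulVec, mul_sub, sub_mul, sub_mul, hsq, two_smul]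
  simp

theorem exists_mem_orthogonalGroup_apply_ne_zero {n : Type*} [Fintype n] [DecidableEq n] {a b : n}
    (hab : a ≠ b) : ∃ O ∈ Matrix.orthogonalGroup n ℝ, O a a ≠ 0 ∧ O b a ≠ 0 := by
  refine ⟨1 - (2 / 5 : ℝ) • Matrix.vecMulVec (Pi.single a 1 + Pi.single b 2)
    (Pi.single a 1 + Pi.single b 2), one_sub_smul_vecMulVec_mem_orthogonalGroup ?_, ?_, ?_⟩ <;>
  norm_num [Matrix.vecMulVec_apply, Matrix.one_apply, Pi.single_apply, hab, hab.symm]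

theorem eq_zero_of_diagonal_mem_orthogonalCommutant (hd : 2 ≤ d) {y : Fin d × Fin d → ℂ}
    (hy : Matrix.diagonal y ∈ orthogonalCommutant d) (hoff : ∀ a b, a ≠ b → y (a, b) = 0) :
    y = 0 := by
  have : Nontrivial (Fin d) := Fin.nontrivial_iff_two_le.mpr hd
  ext ⟨a, b⟩
  obtain rfl | hab := eq_or_ne a b
  · obtain ⟨b, hb⟩ := exists_ne a
    obtain ⟨O, hO, haa, hba⟩ := exists_mem_orthogonalGroup_apply_ne_zero hb.symm
    have h := congrFun₂ (hy O hO) (a, b) (a, a)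
    rw [Matrix.diagonal_mul, Matrix.mul_diagonal, hoff a b hb.symm, zero_mul] at h
    simpa [haa, hba] using h
  · exact hoff a b hab

theorem eq_zero_of_mem_orthogonalCommutant {Y : BipMat d} (hY : Y ∈ orthogonalCommutant d)
    {x y : Fin d} (hxy : x ≠ y) (hΩ : Y (x, x) (y, y) = 0) (h1 : Y (x, y) (x, y) = 0)
    (hF : Y (x, y) (y, x) = 0) : Y = 0 := by
  have transport {i k : Fin d} (hik : i ≠ k) :
      Y (i, i) (k, k) = 0 ∧ Y (i, k) (i, k) = 0 ∧ Y (i, k) (k, i) = 0 := by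
    obtain ⟨π, rfl, rfl⟩ : ∃ π : Equiv.Perm (Fin d), π x = i ∧ π y = k :=
      MulAction.is_two_pretransitive_iff.mp (Equiv.Perm.isMultiplyPretransitive _ 2) hxy hik
    simp only [apply_perm_of_mem_orthogonalCommutant hY, hΩ, h1, hF, and_self]
  have off_diag (p q : Fin d × Fin d) (hpq : p ≠ q) : Y p q = 0 := by
    obtain ⟨i, j⟩ := p
    obtain ⟨k, l⟩ := q
    by_cases h : (i = j ∧ k = l) ∨ (i = k ∧ j = l) ∨ (i = l ∧ j = k)
    · grind
    · exact apply_eq_zero_of_mem_orthogonalCommutant hY h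
  have hdiag : Y = Matrix.diagonal Y.diag :=
    ((Matrix.isDiag_iff_diagonal_diag _).mp fun p q hpq => off_diag p q hpq).symm
  have hd : 2 ≤ d := Fin.nontrivial_iff_two_le.mp ⟨x, y, hxy⟩
  rw [hdiag] at hY
  rw [hdiag, eq_zero_of_diagonal_mem_orthogonalCommutant hd hY fun a b hab => (transport hab).2.1]
  exact Matrix.diagonal_zero

theorem exists_eq_sum_smul_minimalProj_of_mem_orthogonalCommutant (hd : 2 ≤ d) {X : BipMat d}
    (hX : X ∈ orthogonalCommutant d) : ∃ x : Fin 3 → ℂ, X = ∑ i, x i • minimalProj d i := by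
  obtain ⟨x, y, hxy⟩ := Fin.nontrivial_iff_two_le.mpr hd
  have hd' : (d : ℂ) ≠ 0 := Nat.cast_ne_zero.mpr (by omega)
  let a := d * X (x, x) (y, y)
  let b := X (x, y) (x, y)
  let c := X (x, y) (y, x)
  have h_sum : ∑ i, ![a + b + c, b - c, b + c] i • minimalProj d i =
      a • omegaState d + b • 1 + c • flipOp d := by
    simp only [Fin.sum_univ_three, minimalProj, Matrix.cons_val]
    module
  refine ⟨![a + b + c, b - c, b + c], sub_eq_zero.mp <|
    eq_zero_of_mem_orthogonalCommutant ?_ hxy ?_ ?_ ?_⟩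
  · have h := sum_smul_minimalProj_mem_orthogonalCommutant (d := d) ![a + b + c, b - c, b + c]
    rw [orthogonalCommutant_eq_centralizer] at h hX ⊢
    exact sub_mem hX h
  all_goals
    simp only [h_sum, Matrix.sub_apply, Matrix.add_apply, Matrix.smul_apply, omegaState_apply,
      flipOp_apply, Matrix.one_apply, Prod.swap_prod_mk, Prod.mk.injEq, smul_eq_mul]
    simp [a, b, c, hxy, hxy.symm, hd', mul_comm]

theorem eq_covariantState_of_mem_orthogonalCommutant (hd : 2 ≤ d) {X : BipMat d}
    (hX : X ∈ orthogonalCommutant d) (hherm : X.IsHermitian) :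
    X = covariantState d fun i => projWeight i X := by
  have hd0 : d ≠ 0 := by omega
  obtain ⟨x, hx⟩ := exists_eq_sum_smul_minimalProj_of_mem_orthogonalCommutant hd hX
  rw [covariantState_eq_sum hd0]
  conv_lhs => rw [hx]
  refine Finset.sum_congr rfl fun i _ => ?_
  have hrank : (projRank d i : ℂ) ≠ 0 := Complex.ofReal_ne_zero.mpr (projRank_pos hd i).ne'
  rw [← Complex.coe_smul, Complex.ofReal_div, ofReal_projWeight hherm, hx,
    trace_minimalProj_mul_sum_smul hd0, mul_div_cancel_right₀ _ hrank]

end OrthogonalCommutant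

section PartialTrace

variable {d : ℕ}

/-- The partial trace over the second tensor factor. -/
def partialTraceSnd : BipMat d →ₗ[ℂ] Matrix (Fin d) (Fin d) ℂ where
  toFun C := Matrix.of fun i j => ∑ a, C (i, a) (j, a)
  map_add' C D := by
    ext i j
    simp [Finset.sum_add_distrib]
  map_smul' c C := by
    ext i j
    simp [Finset.mul_sum]

/-- The partial trace over the first tensor factor. -/
def partialTraceFst (C : BipMat d) : Matrix (Fin d) (Fin d) ℂ :=
  partialTraceSnd (C.submatrix Prod.swap Prod.swap)

theorem partialTraceSnd_apply (C : BipMat d) (i j : Fin d) :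
    partialTraceSnd C i j = ∑ a, C (i, a) (j, a) := rfl

theorem partialTraceSnd_omegaState : partialTraceSnd (omegaState d) = (d : ℂ)⁻¹ • 1 := by
  ext i j
  simp [partialTraceSnd_apply, omegaState_apply, ite_and, Matrix.one_apply, eq_comm]

theorem partialTraceSnd_one : partialTraceSnd (1 : BipMat d) = (d : ℂ) • 1 := by
  ext i j
  simp [partialTraceSnd_apply, Matrix.one_apply]

theorem partialTraceSnd_flipOp : partialTraceSnd (flipOp d) = 1 := by
  ext i j
  simp [partialTraceSnd_apply, flipOp, ite_and, Matrix.one_apply]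

theorem partialTraceSnd_minimalProj (hd : d ≠ 0) (i : Fin 3) :
    partialTraceSnd (minimalProj d i) = ((projRank d i / d : ℝ) : ℂ) • 1 := by
  have hd' : (d : ℂ) ≠ 0 := Nat.cast_ne_zero.mpr hd
  fin_cases i <;>
  · simp only [minimalProj, projRank, Fin.zero_eta, Fin.mk_one, Fin.reduceFinMk, Matrix.cons_val,
      map_smul, map_sub, map_add, partialTraceSnd_omegaState, partialTraceSnd_one,
      partialTraceSnd_flipOp]
    match_scalars
    field_simp

theorem submatrix_swap_minimalProj (i : Fin 3) :
    (minimalProj d i).submatrix Prod.swap Prod.swap = minimalProj d i := by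
  ext p q
  fin_cases i <;>
  simp [minimalProj, omegaState_apply, flipOp, Matrix.one_apply, eq_comm, and_comm]

theorem submatrix_swap_covariantState (q : Fin 3 → ℝ) :
    (covariantState d q).submatrix Prod.swap Prod.swap = covariantState d q := by
  ext p r
  simp only [covariantState, extremeState, Matrix.submatrix_apply, Matrix.sum_apply,
    Matrix.smul_apply]
  simp only [← Matrix.submatrix_apply (minimalProj d _), submatrix_swap_minimalProj]

theorem partialTraceSnd_covariantState (hd : 2 ≤ d) {q : Fin 3 → ℝ} (hq : ∑ i, q i = 1) :
    partialTraceSnd (covariantState d q) = (d : ℂ)⁻¹ • 1 := by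
  have hd0 : d ≠ 0 := by omega
  have cancel (i : Fin 3) : q i / projRank d i * (projRank d i / d) = q i / d :=
    div_mul_div_cancel₀ (projRank_pos hd i).ne'
  simp only [covariantState_eq_sum hd0, ← Complex.coe_smul, map_sum, map_smul,
    partialTraceSnd_minimalProj hd0, smul_smul, ← Complex.ofReal_mul, cancel, ← Finset.sum_smul,
    ← Complex.ofReal_sum, ← Finset.sum_div, hq]
  simp

theorem partialTraceFst_covariantState (hd : 2 ≤ d) {q : Fin 3 → ℝ} (hq : ∑ i, q i = 1) :
    partialTraceFst (covariantState d q) = (d : ℂ)⁻¹ • 1 := by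
  rw [partialTraceFst, submatrix_swap_covariantState, partialTraceSnd_covariantState hd hq]

end PartialTrace

section Jamiolkowski

variable {d : ℕ}

/-- The linear map with Jamiolkowski matrix `C`. -/
def choiMap (C : BipMat d) : Matrix (Fin d) (Fin d) ℂ →ₗ[ℂ] Matrix (Fin d) (Fin d) ℂ where
  toFun X := Matrix.of fun a b => d * ∑ i, ∑ j, X i j * C (i, a) (j, b)
  map_add' X Y := by
    ext a b
    simp [add_mul, Finset.sum_add_distrib, mul_add]
  map_smul' c X := by
    ext a b
    simp only [Matrix.of_apply, Matrix.smul_apply, smul_eq_mul, RingHom.id_apply, mul_assoc,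
      ← Finset.mul_sum]
    rw [mul_left_comm]

theorem choiMap_apply (C : BipMat d) (X : Matrix (Fin d) (Fin d) ℂ) (a b : Fin d) :
    choiMap C X a b = d * ∑ i, ∑ j, X i j * C (i, a) (j, b) := rfl

theorem jamiolkowski_choiMap (C : BipMat d) : jamiolkowski (choiMap C) = C := by
  ext p q
  have hd : (d : ℂ) ≠ 0 := Nat.cast_ne_zero.mpr p.1.pos.ne'
  simp [jamiolkowski, ampliation, choiMap_apply, omegaState_apply, ite_and, hd]

/-- The partial isometry, up to normalization, that contracts the second factor of
`ℂ^κ ⊗ ℂ^d` with the first factor of `ℂ^d ⊗ ℂ^d`. -/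
def contraction (κ : Type*) [DecidableEq κ] (d : ℕ) :
    Matrix ((κ × Fin d) × Fin d × Fin d) (κ × Fin d) ℂ :=
  Matrix.of fun r p => if r.1.1 = p.1 ∧ r.2.2 = p.2 ∧ r.1.2 = r.2.1 then 1 else 0

theorem ampliation_choiMap {κ : Type*} [Fintype κ] [DecidableEq κ] (C : BipMat d)
    (X : Matrix (κ × Fin d) (κ × Fin d) ℂ) :
    ampliation (choiMap C) X =
      (d : ℂ) • ((contraction κ d).conjTranspose * (X ⊗ₖ C) * contraction κ d) := by
  ext p q
  simp only [ampliation, choiMap_apply, contraction, Matrix.smul_apply, Matrix.mul_apply,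
    Matrix.conjTranspose_apply, Matrix.kroneckerMap_apply, Matrix.of_apply, Fintype.sum_prod_type,
    apply_ite star, star_one, star_zero, ite_and, ite_mul, one_mul, zero_mul, mul_ite, mul_one,
    mul_zero, Finset.sum_ite_irrel, Finset.sum_const_zero, Finset.sum_ite_eq, Finset.sum_ite_eq',
    Finset.mem_univ, if_true, smul_eq_mul]
  rw [Finset.sum_comm]

theorem isCompletelyPositive_choiMap {C : BipMat d} (hC : C.PosSemidef) :
    IsCompletelyPositive (choiMap C) := fun n X hX => by
  rw [ampliation_choiMap]
  exact ((hX.kronecker hC).conjTranspose_mul_mul_same _).smul (Nat.cast_nonneg d)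

theorem trace_choiMap {C : BipMat d} (hC : partialTraceSnd C = (d : ℂ)⁻¹ • 1)
    (X : Matrix (Fin d) (Fin d) ℂ) : (choiMap C X).trace = X.trace := by
  have h (i j : Fin d) : ∑ a, C (i, a) (j, a) = (d : ℂ)⁻¹ * (1 : Matrix (Fin d) (Fin d) ℂ) i j :=
    congrFun₂ hC i j
  calc (choiMap C X).trace = d * ∑ i, ∑ j, X i j * ∑ a, C (i, a) (j, a) := by
        simp only [Matrix.trace, Matrix.diag_apply, choiMap_apply, Finset.mul_sum]
        rw [Finset.sum_comm]
        exact Finset.sum_congr rfl fun i _ => Finset.sum_comm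
    _ = d * ((d : ℂ)⁻¹ * X.trace) := by
        simp [h, Matrix.one_apply, Matrix.trace, Finset.mul_sum, mul_comm]
    _ = X.trace := by
        rcases eq_or_ne d 0 with rfl | hd
        · simp [Matrix.trace]
        · exact mul_inv_cancel_left₀ (Nat.cast_ne_zero.mpr hd) _

theorem choiMap_one {C : BipMat d} (hC : partialTraceFst C = (d : ℂ)⁻¹ • 1) :
    choiMap C 1 = 1 := by
  ext a b
  have hd : (d : ℂ) ≠ 0 := Nat.cast_ne_zero.mpr a.pos.ne'
  have h : ∑ i, C (i, a) (i, b) = (d : ℂ)⁻¹ * (1 : Matrix (Fin d) (Fin d) ℂ) a b :=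
    congrFun₂ hC a b
  simp [choiMap_apply, Matrix.one_apply (n := Fin d), h, hd]

theorem covariantState_mem_unitalStates (hd : 2 ≤ d) {q : Fin 3 → ℝ}
    (hq : q ∈ stdSimplex ℝ (Fin 3)) : covariantState d q ∈ unitalStates d :=
  ⟨choiMap (covariantState d q),
    { completelyPositive := isCompletelyPositive_choiMap (posSemidef_covariantState hd hq.1)
      tracePreserving := trace_choiMap (partialTraceSnd_covariantState hd hq.2)
      unital := choiMap_one (partialTraceFst_covariantState hd hq.2) },
    jamiolkowski_choiMap _⟩

theorem posSemidef_jamiolkowski {T : Matrix (Fin d) (Fin d) ℂ →ₗ[ℂ] Matrix (Fin d) (Fin d) ℂ}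
    (hT : IsCompletelyPositive T) : (jamiolkowski T).PosSemidef :=
  hT d _ (Matrix.posSemidef_vecMulVec_self_star _)

theorem trace_jamiolkowski (hd : d ≠ 0)
    {T : Matrix (Fin d) (Fin d) ℂ →ₗ[ℂ] Matrix (Fin d) (Fin d) ℂ}
    (hT : ∀ X, (T X).trace = X.trace) : (jamiolkowski T).trace = 1 := by
  rw [← trace_omegaState hd]
  simp only [Matrix.trace, Matrix.diag_apply, jamiolkowski, ampliation, Matrix.of_apply,
    Fintype.sum_prod_type]
  exact Finset.sum_congr rfl fun i _ => hT _

theorem exists_eq_covariantState_of_mem_unitalStates (hd : 2 ≤ d) {ρ : BipMat d}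
    (hρ : ρ ∈ unitalStates d ∩ orthogonalCommutant d) :
    ∃ q ∈ stdSimplex ℝ (Fin 3), ρ = covariantState d q := by
  obtain ⟨⟨T, hT, rfl⟩, hc⟩ := hρ
  have hpos := posSemidef_jamiolkowski hT.completelyPositive
  refine ⟨_, ⟨fun i => projWeight_nonneg (by omega) hpos i, ?_⟩,
    eq_covariantState_of_mem_orthogonalCommutant hd hc hpos.isHermitian⟩
  rw [sum_projWeight (by omega), trace_jamiolkowski (by omega) hT.tracePreserving, Complex.one_re]

theorem jamiolkowski_wernerHolevo (hd : 2 ≤ d) :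
    jamiolkowski (wernerHolevo d) = extremeState d 1 := by
  have hd0 : (d : ℂ) ≠ 0 := Nat.cast_ne_zero.mpr (by omega)
  have hd1 : (d : ℂ) - 1 ≠ 0 := sub_ne_zero.mpr (by exact_mod_cast (by omega : d ≠ 1))
  have scalar : (projRank d 1 : ℂ)⁻¹ * (1 / 2) = ((d : ℂ) - 1)⁻¹ * (d : ℂ)⁻¹ := by
    simp only [projRank, Matrix.cons_val]
    push_cast
    field_simp
  rw [extremeState_eq_smul (by omega), ← Complex.coe_smul, Complex.ofReal_inv, minimalProj,
    Matrix.cons_val_one, Matrix.cons_val_zero, smul_smul, scalar, mul_smul]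
  ext ⟨i, a⟩ ⟨j, b⟩
  simp only [jamiolkowski, ampliation, wernerHolevo, LinearMap.coe_mk, AddHom.coe_mk,
    Matrix.of_apply, Matrix.smul_apply, Matrix.sub_apply, Matrix.transpose_apply,
    Matrix.trace, Matrix.diag_apply, omegaState_apply, Matrix.one_apply, flipOp,
    Prod.mk.injEq, smul_eq_mul, ite_and, Finset.sum_ite_eq, Finset.mem_univ, if_true]
  congr 1
  grind

end Jamiolkowski

section UnitaryMixtures

variable {d : ℕ}

/-- The Jamiolkowski state `(1 ⊗ U) |Ω⟩⟨Ω| (1 ⊗ Uᴴ)` of the channel `X ↦ U X Uᴴ`, as a rank-one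
operator. -/
noncomputable def unitaryState (U : Matrix (Fin d) (Fin d) ℂ) : BipMat d :=
  Matrix.vecMulVec (entangledVec U) (star (entangledVec U))

theorem unitaryMixtures_eq_convexHull_image :
    unitaryMixtures d =
      convexHull ℝ (unitaryState '' (Matrix.unitaryGroup (Fin d) ℂ : Set _)) := by
  have state_eq (U : Matrix (Fin d) (Fin d) ℂ) :
      ((1 : Matrix (Fin d) (Fin d) ℂ) ⊗ₖ U) * omegaState d *
        ((1 : Matrix (Fin d) (Fin d) ℂ) ⊗ₖ U.conjTranspose) = unitaryState U := by
    rw [unitaryState, entangledVec, Matrix.star_mulVec, Matrix.conjTranspose_kronecker,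
      Matrix.conjTranspose_one, omegaState, Matrix.mul_vecMulVec, Matrix.vecMulVec_mul]
  simp only [unitaryMixtures, state_eq, Set.image, SetLike.mem_coe, eq_comm]

theorem unitaryState_mem_unitaryMixtures {U : Matrix (Fin d) (Fin d) ℂ}
    (hU : U ∈ Matrix.unitaryGroup (Fin d) ℂ) : unitaryState U ∈ unitaryMixtures d := by
  rw [unitaryMixtures_eq_convexHull_image]
  exact subset_convexHull _ _ ⟨U, hU, rfl⟩

theorem convex_unitaryMixtures : Convex ℝ (unitaryMixtures d) := convex_convexHull _ _

theorem unitaryMixtures_subset {S : Set (BipMat d)} (hS : Convex ℝ S)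
    (h : ∀ U ∈ Matrix.unitaryGroup (Fin d) ℂ, unitaryState U ∈ S) : unitaryMixtures d ⊆ S := by
  rw [unitaryMixtures_eq_convexHull_image]
  exact convexHull_min (Set.image_subset_iff.mpr h) hS

theorem isCompact_unitaryGroup {n : Type*} [Fintype n] [DecidableEq n] :
    IsCompact (Matrix.unitaryGroup n ℂ : Set (Matrix n n ℂ)) := by
  have hK : @IsCompact (Matrix n n ℂ) _
      (Set.univ.pi fun _ => Set.univ.pi fun _ => Metric.closedBall (0 : ℂ) 1) :=
    isCompact_univ_pi fun _ => isCompact_univ_pi fun _ => isCompact_closedBall _ _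
  refine hK.of_isClosed_subset isClosed_unitary fun U hU i _ j _ => ?_
  simpa only [mem_closedBall_zero_iff] using entry_norm_bound_of_unitary hU i j

theorem continuous_unitaryState : Continuous (unitaryState (d := d)) := by
  refine continuous_matrix fun p q => ?_
  simp only [unitaryState, vecMulVec_entangledVec_apply]
  fun_prop

theorem isCompact_unitaryMixtures : IsCompact (unitaryMixtures d) := by
  rw [unitaryMixtures_eq_convexHull_image]
  exact isCompact_convexHull_of_finiteDimensional
    (isCompact_unitaryGroup.image continuous_unitaryState)

theorem posSemidef_of_mem_unitaryMixtures {σ : BipMat d} (hσ : σ ∈ unitaryMixtures d) :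
    σ.PosSemidef :=
  unitaryMixtures_subset (S := {X | X.PosSemidef})
    (fun _ hX _ hY _ _ ha hb _ => (hX.smul ha).add (hY.smul hb))
    (fun _ _ => Matrix.posSemidef_vecMulVec_self_star _) hσ

theorem kronecker_mul_unitaryState_mul_conjTranspose (A B U : Matrix (Fin d) (Fin d) ℂ) :
    (A ⊗ₖ B) * unitaryState U * (A ⊗ₖ B).conjTranspose = unitaryState (B * U * A.transpose) := by
  rw [unitaryState, Matrix.mul_vecMulVec, Matrix.vecMulVec_mul, ← Matrix.star_mulVec,
    kronecker_mulVec_entangledVec, unitaryState]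

theorem kronecker_conj_mem_unitaryMixtures {A B : Matrix (Fin d) (Fin d) ℂ}
    (hA : A ∈ Matrix.unitaryGroup (Fin d) ℂ) (hB : B ∈ Matrix.unitaryGroup (Fin d) ℂ)
    {σ : BipMat d} (hσ : σ ∈ unitaryMixtures d) :
    (A ⊗ₖ B) * σ * (A ⊗ₖ B).conjTranspose ∈ unitaryMixtures d := by
  refine unitaryMixtures_subset (convex_unitaryMixtures.linear_preimage
    (LinearMap.mulRight ℝ (A ⊗ₖ B).conjTranspose ∘ₗ LinearMap.mulLeft ℝ (A ⊗ₖ B)))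
    (fun U hU => ?_) hσ
  simp only [Set.mem_preimage, LinearMap.comp_apply, LinearMap.mulLeft_apply,
    LinearMap.mulRight_apply, kronecker_mul_unitaryState_mul_conjTranspose]
  exact unitaryState_mem_unitaryMixtures
    (mul_mem (mul_mem hB hU) (Matrix.transpose_mem_unitaryGroup_iff.mpr hA))

end UnitaryMixtures

section WeightsOfUnitaries

open scoped Matrix.Norms.Frobenius

variable {d : ℕ}

theorem star_entangledVec_dotProduct_self (A : Matrix (Fin d) (Fin d) ℂ) :
    star (entangledVec A) ⬝ᵥ entangledVec A = ((‖A‖ ^ 2 / d : ℝ) : ℂ) := by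
  rw [star_entangledVec_dotProduct_entangledVec, Matrix.trace_mul_comm,
    ← frobenius_norm_sq_eq_trace, Complex.ofReal_div, Complex.ofReal_natCast, div_eq_inv_mul]

theorem trace_unitaryState {U : Matrix (Fin d) (Fin d) ℂ} (hd : d ≠ 0)
    (hU : U ∈ Matrix.unitaryGroup (Fin d) ℂ) : (unitaryState U).trace = 1 := by
  have hd' : (d : ℝ) ≠ 0 := Nat.cast_ne_zero.mpr hd
  rw [unitaryState, Matrix.trace_vecMulVec, dotProduct_comm, star_entangledVec_dotProduct_self,
    frobenius_norm_sq_of_mem_unitaryGroup hU, Fintype.card_fin, div_self hd', Complex.ofReal_one]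

theorem projWeight_unitaryState (hd : d ≠ 0) {i : Fin 3} {U B : Matrix (Fin d) (Fin d) ℂ}
    (h : (minimalProj d i).mulVec (entangledVec U) = entangledVec B) :
    projWeight i (unitaryState U) = ‖B‖ ^ 2 / d := by
  have conj_eq : minimalProj d i * unitaryState U * minimalProj d i =
      Matrix.vecMulVec (entangledVec B) (star (entangledVec B)) := by
    conv_lhs => rhs; rw [← (isHermitian_minimalProj i).eq]
    rw [unitaryState, Matrix.mul_vecMulVec, Matrix.vecMulVec_mul, ← Matrix.star_mulVec, h]
  rw [projWeight_apply, ← ((completeOrthogonalIdempotents_minimalProj hd).idem i).eq, mul_assoc,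
    Matrix.trace_mul_comm, conj_eq, Matrix.trace_vecMulVec, dotProduct_comm,
    star_entangledVec_dotProduct_self, Complex.ofReal_re]

theorem projWeight_zero_unitaryState (hd : d ≠ 0) (U : Matrix (Fin d) (Fin d) ℂ) :
    projWeight 0 (unitaryState U) = ‖U.trace‖ ^ 2 / d ^ 2 := by
  have project : (minimalProj d 0).mulVec (entangledVec U) =
      entangledVec (((d : ℂ)⁻¹ * U.trace) • 1) := by
    rw [minimalProj, Matrix.cons_val_zero, omegaState_eq_vecMulVec, Matrix.vecMulVec_mulVec,
      star_entangledVec_dotProduct_entangledVec, Matrix.conjTranspose_one, one_mul,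
      entangledVec_smul, op_smul_eq_smul]
  have hd' : (d : ℝ) ≠ 0 := Nat.cast_ne_zero.mpr hd
  rw [projWeight_unitaryState hd project, norm_smul, mul_pow,
    frobenius_norm_sq_of_mem_unitaryGroup (one_mem _), norm_mul, norm_inv, Complex.norm_natCast,
    Fintype.card_fin]
  field_simp

theorem projWeight_one_unitaryState (hd : d ≠ 0) (U : Matrix (Fin d) (Fin d) ℂ) :
    projWeight 1 (unitaryState U) = ‖U - U.transpose‖ ^ 2 / (4 * d) := by
  have project : (minimalProj d 1).mulVec (entangledVec U) =
      entangledVec ((1 / 2 : ℂ) • (U - U.transpose)) := by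
    rw [minimalProj, Matrix.cons_val_one, Matrix.cons_val_zero, Matrix.smul_mulVec,
      Matrix.sub_mulVec, Matrix.one_mulVec, flipOp_mulVec_entangledVec, entangledVec_smul,
      entangledVec_sub]
  rw [projWeight_unitaryState hd project, norm_smul, mul_pow]
  norm_num
  ring

theorem sum_projWeight_of_mem_unitaryMixtures (hd : d ≠ 0) {σ : BipMat d}
    (hσ : σ ∈ unitaryMixtures d) : ∑ i, projWeight i σ = 1 := by
  have hconv : Convex ℝ {X : BipMat d | (∑ i, projWeight i) X = 1} :=
    (convex_singleton (1 : ℝ)).linear_preimage (∑ i, projWeight (d := d) i)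
  have h := unitaryMixtures_subset hconv (fun U hU => ?_) hσ
  · simpa only [Set.mem_ofPred_eq, LinearMap.sum_apply] using h
  · rw [Set.mem_ofPred_eq, LinearMap.sum_apply, sum_projWeight hd, trace_unitaryState hd hU,
      Complex.one_re]

end WeightsOfUnitaries

section Twirl

open scoped Matrix.Norms.Frobenius

variable {d : ℕ}

theorem continuous_frobenius_norm_sq {m n : Type*} [Fintype m] [Fintype n] :
    @Continuous (Matrix m n ℂ) ℝ Pi.topologicalSpace _ fun A => ‖A‖ ^ 2 := by
  simp only [frobenius_norm_sq]
  fun_prop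

theorem covariantState_projWeight_mem_unitaryMixtures (hd : 2 ≤ d) {σ : BipMat d}
    (hσ : σ ∈ unitaryMixtures d) :
    covariantState d (fun i => projWeight i σ) ∈ unitaryMixtures d := by
  set fiber : Set (BipMat d) := ⋂ i, {X | projWeight i X = projWeight i σ} with hfiber
  have mem_fiber {X : BipMat d} : X ∈ fiber ↔ ∀ i, projWeight i X = projWeight i σ := by
    simp only [hfiber, Set.mem_iInter, Set.mem_ofPred_eq]
  have convex_fiber : Convex ℝ fiber :=
    convex_iInter fun i => (convex_singleton (projWeight i σ)).linear_preimage (projWeight i)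
  have isClosed_fiber : @IsClosed (BipMat d) Pi.topologicalSpace fiber :=
    isClosed_iInter fun i =>
      isClosed_singleton.preimage (projWeight (d := d) i).continuous_of_finiteDimensional
  obtain ⟨τ, ⟨hτ, hτ_fiber⟩, hτ_fixed⟩ := exists_common_fixedPoint_of_strictConvexOn
    (isCompact_unitaryMixtures.inter_right isClosed_fiber) ⟨σ, hσ, mem_fiber.mpr fun _ => rfl⟩
    (strictConvexOn_frobenius_norm_sq (convex_unitaryMixtures.inter convex_fiber))
    continuous_frobenius_norm_sq.continuousOn
  have τ_mem : τ ∈ orthogonalCommutant d := by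
    intro O hO
    have hO_unitary := map_ofReal_mem_unitaryGroup hO
    have hW := Matrix.kronecker_mem_unitary hO_unitary hO_unitary
    set W : BipMat d := O.map Complex.ofReal ⊗ₖ O.map Complex.ofReal
    have hcomm (i : Fin 3) : Commute (minimalProj d i) W :=
      commute_minimalProj_kronecker (map_ofReal_mem_orthogonalGroup hO) i
    have fixed : W * τ * W.conjTranspose = τ := by
      refine hτ_fixed (fun X => W * X * W.conjTranspose) (fun X hX => ⟨?_, ?_⟩) fun X _ => ?_
      · exact kronecker_conj_mem_unitaryMixtures hO_unitary hO_unitary hX.1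
      · exact mem_fiber.mpr fun i => (projWeight_conj hW (hcomm i) X).trans (mem_fiber.mp hX.2 i)
      · rw [← Matrix.star_eq_conjTranspose, frobenius_norm_mul_unitary (Unitary.star_mem hW),
          frobenius_norm_unitary_mul hW]
    conv_lhs => rw [← fixed]
    rw [mul_assoc, ← Matrix.star_eq_conjTranspose, Unitary.star_mul_self_of_mem hW, mul_one]
  have hτ_eq := eq_covariantState_of_mem_orthogonalCommutant hd τ_mem
    (posSemidef_of_mem_unitaryMixtures hτ).isHermitian
  simp only [mem_fiber.mp hτ_fiber] at hτ_eq
  exact hτ_eq ▸ hτ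

end Twirl

section PlanarStates

variable {d : ℕ}

/-- The covariant operator with weights `x`, `y` and `1 - x - y`: it has trace one, so it is
determined by its weights on `P₀` and `P₁`. -/
noncomputable def planarState (d : ℕ) (x y : ℝ) : BipMat d := covariantState d ![x, y, 1 - x - y]

theorem covariantState_eq_planarState {q : Fin 3 → ℝ} (hq : ∑ i, q i = 1) :
    covariantState d q = planarState d (q 0) (q 1) := by
  rw [Fin.sum_univ_three] at hq
  have h : q 2 = 1 - q 0 - q 1 := by linarith
  rw [planarState, ← h]
  congr 1
  ext i
  fin_cases i <;> rfl

theorem planarState_smul_add_smul {a b : ℝ} (hab : a + b = 1) (x y x' y' : ℝ) :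
    a • planarState d x y + b • planarState d x' y' =
      planarState d (a * x + b * x') (a * y + b * y') := by
  rw [planarState, planarState, planarState, ← covariantState_smul, ← covariantState_smul,
    ← covariantState_add]
  congr 1
  ext i
  fin_cases i
  · rfl
  · rfl
  · simp only [Fin.reduceFinMk, Pi.add_apply, Pi.smul_apply, Matrix.cons_val, smul_eq_mul]
    linear_combination hab

theorem projWeight_zero_planarState (hd : 2 ≤ d) (x y : ℝ) :
    projWeight 0 (planarState d x y) = x :=
  projWeight_covariantState hd _ 0

theorem projWeight_one_planarState (hd : 2 ≤ d) (x y : ℝ) :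
    projWeight 1 (planarState d x y) = y :=
  projWeight_covariantState hd _ 1

theorem planarState_projWeight_mem_unitaryMixtures (hd : 2 ≤ d) {σ : BipMat d}
    (hσ : σ ∈ unitaryMixtures d) :
    planarState d (projWeight 0 σ) (projWeight 1 σ) ∈ unitaryMixtures d := by
  rw [← covariantState_eq_planarState (q := fun i => projWeight i σ)
    (sum_projWeight_of_mem_unitaryMixtures (by omega) hσ)]
  exact covariantState_projWeight_mem_unitaryMixtures hd hσ

end PlanarStates

section ExplicitUnitaries

open scoped Matrix.Norms.Frobenius

section Matrices

variable {m n R : Type*}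

theorem conjTranspose_J [DecidableEq n] [CommRing R] [StarRing R] :
    (Matrix.J n R).conjTranspose = -Matrix.J n R := by
  simp [Matrix.J, Matrix.fromBlocks_conjTranspose, Matrix.fromBlocks_neg]

variable [Fintype m] [Fintype n]

theorem trace_submatrix_equiv [AddCommMonoid R] (e : m ≃ n) (A : Matrix n n R) :
    (A.submatrix e e).trace = A.trace :=
  Fintype.sum_equiv e _ _ fun _ => rfl

theorem frobenius_norm_submatrix_equiv (e : m ≃ n) (A : Matrix n n ℂ) :
    ‖A.submatrix e e‖ = ‖A‖ := by
  rw [← sq_eq_sq₀ (norm_nonneg _) (norm_nonneg _), frobenius_norm_sq, frobenius_norm_sq]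
  exact Fintype.sum_equiv e _ _ fun i => Fintype.sum_equiv e _ _ fun j => rfl

theorem trace_fromBlocks_diagonal [AddCommMonoid R] (A : Matrix m m R) (B : Matrix n n R) :
    (Matrix.fromBlocks A 0 0 B).trace = A.trace + B.trace := by
  simp [Matrix.trace, Fintype.sum_sum_type]

theorem frobenius_norm_sq_fromBlocks_diagonal (A : Matrix m m ℂ) (B : Matrix n n ℂ) :
    ‖Matrix.fromBlocks A 0 0 B‖ ^ 2 = ‖A‖ ^ 2 + ‖B‖ ^ 2 := by
  simp [frobenius_norm_sq, Fintype.sum_sum_type]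

variable [DecidableEq m] [DecidableEq n]

theorem submatrix_equiv_mem_unitaryGroup [CommRing R] [StarRing R] (e : m ≃ n)
    {U : Matrix n n R} (hU : U ∈ Matrix.unitaryGroup n R) :
    U.submatrix e e ∈ Matrix.unitaryGroup m R := by
  rw [Matrix.mem_unitaryGroup_iff, Matrix.star_eq_conjTranspose, Matrix.conjTranspose_submatrix,
    Matrix.submatrix_mul_equiv, ← Matrix.star_eq_conjTranspose, Matrix.mem_unitaryGroup_iff.mp hU,
    Matrix.submatrix_one_equiv]

theorem fromBlocks_diagonal_mem_unitaryGroup [CommRing R] [StarRing R] {A : Matrix m m R}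
    {B : Matrix n n R} (hA : A ∈ Matrix.unitaryGroup m R) (hB : B ∈ Matrix.unitaryGroup n R) :
    Matrix.fromBlocks A 0 0 B ∈ Matrix.unitaryGroup (m ⊕ n) R := by
  rw [Matrix.mem_unitaryGroup_iff, Matrix.star_eq_conjTranspose] at hA hB ⊢
  simp [Matrix.fromBlocks_conjTranspose, Matrix.fromBlocks_multiply, hA, hB]

theorem smul_one_add_smul_mem_unitaryGroup {W : Matrix n n ℂ}
    (hW : W ∈ Matrix.unitaryGroup n ℂ) (hskew : W.conjTranspose = -W) {c s : ℝ}
    (hcs : c ^ 2 + s ^ 2 = 1) : c • 1 + s • W ∈ Matrix.unitaryGroup n ℂ := by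
  have hWW : W * W = -1 := by
    rw [← neg_eq_iff_eq_neg, ← mul_neg, ← hskew]
    exact Matrix.mem_unitaryGroup_iff.mp hW
  rw [Matrix.mem_unitaryGroup_iff, Matrix.star_eq_conjTranspose, Matrix.conjTranspose_add,
    Matrix.conjTranspose_smul, Matrix.conjTranspose_smul, hskew, Matrix.conjTranspose_one,
    star_trivial, star_trivial]
  calc (c • 1 + s • W) * (c • 1 + s • -W) = c ^ 2 • 1 - s ^ 2 • (W * W) := by
        simp only [add_mul, mul_add, Matrix.smul_mul, Matrix.mul_smul, one_mul, mul_one, mul_neg]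
        module
    _ = 1 := by rw [hWW, smul_neg, sub_neg_eq_add, ← add_smul, hcs, one_smul]

theorem J_mem_unitaryGroup [CommRing R] [StarRing R] :
    Matrix.J n R ∈ Matrix.unitaryGroup (n ⊕ n) R := by
  rw [Matrix.mem_unitaryGroup_iff, Matrix.star_eq_conjTranspose, conjTranspose_J, mul_neg,
    Matrix.J_squared, neg_neg]

theorem trace_J [CommRing R] : (Matrix.J n R).trace = 0 := by
  simp [Matrix.J, Matrix.trace]

theorem frobenius_norm_sq_J_sub_transpose :
    ‖Matrix.J n ℂ - (Matrix.J n ℂ).transpose‖ ^ 2 = 8 * Fintype.card n := by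
  rw [Matrix.J_transpose, sub_neg_eq_add, ← two_smul ℝ, norm_smul, mul_pow,
    frobenius_norm_sq_of_mem_unitaryGroup J_mem_unitaryGroup, Fintype.card_sum]
  norm_num
  ring

end Matrices

variable {d : ℕ} {m n : Type*} [Fintype m] [DecidableEq m] [Fintype n] [DecidableEq n]

theorem planarState_mem_of_mem_unitaryGroup (hd : 2 ≤ d) (hn : Fintype.card n = d)
    {U : Matrix n n ℂ} (hU : U ∈ Matrix.unitaryGroup n ℂ) :
    planarState d (‖U.trace‖ ^ 2 / d ^ 2) (‖U - U.transpose‖ ^ 2 / (4 * d)) ∈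
      unitaryMixtures d := by
  let e : Fin d ≃ n := (Fintype.equivFinOfCardEq hn).symm
  have h := planarState_projWeight_mem_unitaryMixtures hd
    (unitaryState_mem_unitaryMixtures (submatrix_equiv_mem_unitaryGroup e hU))
  have hd0 : d ≠ 0 := by omega
  have sub_eq : U.submatrix e e - (U.submatrix e e).transpose =
      (U - U.transpose).submatrix e e := rfl
  rwa [projWeight_zero_unitaryState hd0, projWeight_one_unitaryState hd0, trace_submatrix_equiv,
    sub_eq, frobenius_norm_submatrix_equiv] at h

theorem planarState_mem_of_directSum (hd : 2 ≤ d) (hmn : Fintype.card m + Fintype.card n = d)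
    {A : Matrix m m ℂ} (hA : A ∈ Matrix.unitaryGroup m ℂ) {B : Matrix n n ℂ}
    (hB : B ∈ Matrix.unitaryGroup n ℂ) :
    planarState d (‖A.trace + B.trace‖ ^ 2 / d ^ 2)
      ((‖A - A.transpose‖ ^ 2 + ‖B - B.transpose‖ ^ 2) / (4 * d)) ∈ unitaryMixtures d := by
  have h := planarState_mem_of_mem_unitaryGroup hd (Fintype.card_sum.trans hmn)
    (fromBlocks_diagonal_mem_unitaryGroup hA hB)
  have sub_eq : Matrix.fromBlocks A 0 0 B - (Matrix.fromBlocks A 0 0 B).transpose =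
      Matrix.fromBlocks (A - A.transpose) 0 0 (B - B.transpose) := by
    simp only [Matrix.fromBlocks_transpose, Matrix.transpose_zero, sub_eq_add_neg,
      Matrix.fromBlocks_neg, Matrix.fromBlocks_add, neg_zero, add_zero]
  rwa [sub_eq, trace_fromBlocks_diagonal, frobenius_norm_sq_fromBlocks_diagonal] at h

theorem planarState_one_zero_mem_unitaryMixtures (hd : 2 ≤ d) :
    planarState d 1 0 ∈ unitaryMixtures d := by
  have hd' : (d : ℝ) ≠ 0 := by
    rw [Nat.cast_ne_zero]
    omega
  have h := planarState_mem_of_mem_unitaryGroup hd (Fintype.card_fin d) (one_mem _)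
  rwa [Matrix.transpose_one, sub_self, norm_zero, zero_pow two_ne_zero, zero_div,
    Matrix.trace_one, Fintype.card_fin, Complex.norm_natCast, div_self (pow_ne_zero 2 hd')] at h

theorem planarState_zero_zero_mem_unitaryMixtures (hd : 2 ≤ d) :
    planarState d 0 0 ∈ unitaryMixtures d := by
  have hd0 : d ≠ 0 := by omega
  obtain ⟨ζ, hζ⟩ : ∃ ζ : ℂ, IsPrimitiveRoot ζ d := ⟨_, Complex.isPrimitiveRoot_exp d hd0⟩
  set U : Matrix (Fin d) (Fin d) ℂ := Matrix.diagonal fun i => ζ ^ (i : ℕ)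
  have hU : U ∈ Matrix.unitaryGroup (Fin d) ℂ := by
    rw [Matrix.mem_unitaryGroup_iff, Matrix.star_eq_conjTranspose, Matrix.diagonal_conjTranspose,
      Matrix.diagonal_mul_diagonal, ← Matrix.diagonal_one]
    congr 1
    ext i
    rw [Pi.star_apply, Complex.star_def, Complex.mul_conj', norm_pow, hζ.norm'_eq_one hd0]
    norm_num
  have hU_trace : U.trace = 0 := by
    rw [Matrix.trace_diagonal, Fin.sum_univ_eq_sum_range (fun i => ζ ^ i),
      hζ.geom_sum_eq_zero (by omega)]
  have h := planarState_mem_of_mem_unitaryGroup hd (Fintype.card_fin d) hU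
  rwa [hU_trace, Matrix.diagonal_transpose, sub_self, norm_zero, norm_zero,
    zero_pow two_ne_zero, zero_div, zero_div] at h

theorem planarState_curve_mem_unitaryMixtures (hd : 3 ≤ d) (hodd : Odd d) {c : ℝ} (hc : 0 ≤ c)
    (hc1 : c ≤ 1) :
    planarState d ((1 + (d - 1) * c) ^ 2 / d ^ 2) ((d - 1) / d * (1 - c ^ 2)) ∈
      unitaryMixtures d := by
  obtain ⟨m, rfl⟩ := hodd
  obtain ⟨s, hcs⟩ : ∃ s : ℝ, c ^ 2 + s ^ 2 = 1 :=
    ⟨√(1 - c ^ 2), by rw [Real.sq_sqrt (by nlinarith)]; ring⟩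
  set A : Matrix (Fin m ⊕ Fin m) (Fin m ⊕ Fin m) ℂ := c • 1 + s • Matrix.J (Fin m) ℂ with hA_def
  have hA : A ∈ Matrix.unitaryGroup _ ℂ :=
    smul_one_add_smul_mem_unitaryGroup J_mem_unitaryGroup conjTranspose_J hcs
  have trace_eq : A.trace + (1 : Matrix Unit Unit ℂ).trace = ((1 + 2 * m * c : ℝ) : ℂ) := by
    rw [hA_def, Matrix.trace_add, Matrix.trace_smul, Matrix.trace_smul, trace_J, Matrix.trace_one,
      Matrix.trace_one, smul_zero, add_zero, Fintype.card_sum, Fintype.card_fin,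
      Fintype.card_unit, Complex.real_smul]
    push_cast
    ring
  have norm_eq : ‖A - A.transpose‖ ^ 2 = s ^ 2 * (8 * m) := by
    have h : A - A.transpose = s • (Matrix.J (Fin m) ℂ - (Matrix.J (Fin m) ℂ).transpose) := by
      rw [hA_def, Matrix.transpose_add, Matrix.transpose_smul, Matrix.transpose_smul,
        Matrix.transpose_one]
      module
    rw [h, norm_smul, mul_pow, Real.norm_eq_abs, sq_abs, frobenius_norm_sq_J_sub_transpose,
      Fintype.card_fin]
  have h := planarState_mem_of_directSum (d := 2 * m + 1) (n := Unit) (by omega)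
    (by rw [Fintype.card_sum, Fintype.card_fin, Fintype.card_unit]; ring) hA (one_mem _)
  rw [trace_eq, norm_eq, Complex.norm_real, Real.norm_eq_abs, sq_abs, Matrix.transpose_one,
    sub_self, norm_zero, show s ^ 2 = 1 - c ^ 2 by linarith] at h
  convert h using 2
  · push_cast
    ring
  · push_cast
    field_simp
    ring

/-- A traceless unitary whose antisymmetric part is as large as possible in dimension three.
With the isotropic unit vector `v = ((1 + i) / 2, (1 - i) / 2, 0)` it is
`v̄ v̄ᵀ + v e₃ᵀ - e₃ vᵀ`. -/
noncomputable def tracelessUnitary : Matrix (Fin 3) (Fin 3) ℂ :=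
  !![-Complex.I / 2, 1 / 2, (1 + Complex.I) / 2;
    1 / 2, Complex.I / 2, (1 - Complex.I) / 2;
    -(1 + Complex.I) / 2, -(1 - Complex.I) / 2, 0]

theorem tracelessUnitary_mem_unitaryGroup :
    tracelessUnitary ∈ Matrix.unitaryGroup (Fin 3) ℂ := by
  rw [Matrix.mem_unitaryGroup_iff, Matrix.star_eq_conjTranspose]
  ext i j
  fin_cases i <;> fin_cases j <;>
    simp [tracelessUnitary, Matrix.mul_apply, Fin.sum_univ_three, Complex.ext_iff, map_ofNat] <;>
    norm_num

theorem trace_tracelessUnitary : tracelessUnitary.trace = 0 := by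
  rw [Matrix.trace_fin_three]
  simp only [tracelessUnitary, Matrix.of_apply, Matrix.cons_val]
  ring

theorem frobenius_norm_sq_tracelessUnitary_sub_transpose :
    ‖tracelessUnitary - tracelessUnitary.transpose‖ ^ 2 = 8 := by
  simp only [frobenius_norm_sq, ← Complex.normSq_eq_norm_sq, Complex.normSq_apply,
    Fin.sum_univ_three, tracelessUnitary, Matrix.sub_apply, Matrix.transpose_apply,
    Matrix.of_apply, Matrix.cons_val, Matrix.cons_val', Matrix.cons_val_zero, Matrix.cons_val_one]
  norm_num

theorem planarState_zero_mem_unitaryMixtures (hd : 3 ≤ d) (hodd : Odd d) :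
    planarState d 0 ((d - 1) / d) ∈ unitaryMixtures d := by
  obtain ⟨m, rfl⟩ : ∃ m, d = 2 * m + 3 := by
    obtain ⟨m, rfl⟩ := hodd
    exact ⟨m - 1, by omega⟩
  have h := planarState_mem_of_directSum (d := 2 * m + 3) (by omega)
    (by simp only [Fintype.card_sum, Fintype.card_fin]; ring)
    (J_mem_unitaryGroup (n := Fin m)) tracelessUnitary_mem_unitaryGroup
  rw [trace_J, trace_tracelessUnitary, frobenius_norm_sq_J_sub_transpose,
    frobenius_norm_sq_tracelessUnitary_sub_transpose, Fintype.card_fin, add_zero, norm_zero,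
    zero_pow two_ne_zero, zero_div] at h
  convert h using 1
  congr 1
  push_cast
  field_simp
  ring

end ExplicitUnitaries

section SupportingLines

variable {d : ℕ}

theorem le_of_mem_unitaryMixtures_of_odd (hodd : Odd d) {c : ℝ} (hc : 0 ≤ c) {σ : BipMat d}
    (hσ : σ ∈ unitaryMixtures d) :
    d * ((1 + (d - 1) * c) * projWeight 1 σ + d * c * projWeight 0 σ) ≤
      (1 + (d - 1) * c) * (d - 1 + c) := by
  let L : BipMat d →ₗ[ℝ] ℝ :=
    (d : ℝ) • ((1 + (d - 1) * c) • projWeight 1 + (d * c) • projWeight 0)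
  refine unitaryMixtures_subset (S := {X | L X ≤ (1 + (d - 1) * c) * (d - 1 + c)})
    (convex_halfSpace_le L.isLinear _) (fun U hU => ?_) hσ
  have hd : d ≠ 0 := hodd.pos.ne'
  have h := mul_norm_trace_sq_le_of_mem_unitaryGroup (by rwa [Fintype.card_fin]) hU hc
  rw [Fintype.card_fin] at h
  simp only [Set.mem_ofPred_eq, L, LinearMap.smul_apply, LinearMap.add_apply, smul_eq_mul,
    projWeight_zero_unitaryState hd, projWeight_one_unitaryState hd]
  field_simp
  linarith

/-- The linear functional which is `1` on the line supporting, at the curve parameter `c`, the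
region of weights of mixtures of unitary channels, and `0` at the weights `(0, 0, 1)`. -/
noncomputable def tangentFunctional (d : ℕ) (c : ℝ) : BipMat d →ₗ[ℝ] ℝ :=
  (d / ((1 + (d - 1) * c) * (d - 1 + c))) •
    ((1 + (d - 1) * c) • projWeight 1 + (d * c) • projWeight 0)

theorem tangentFunctional_apply (c : ℝ) (X : BipMat d) :
    tangentFunctional d c X =
      d * ((1 + (d - 1) * c) * projWeight 1 X + d * c * projWeight 0 X) /
        ((1 + (d - 1) * c) * (d - 1 + c)) := by
  simp only [tangentFunctional, LinearMap.smul_apply, LinearMap.add_apply, smul_eq_mul]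
  ring

theorem tangentFunctional_mem_Icc (hodd : Odd d) {c : ℝ} (hc : 0 ≤ c) {σ : BipMat d}
    (hσ : σ ∈ unitaryMixtures d) : tangentFunctional d c σ ∈ Set.Icc 0 1 := by
  have hd : (0 : ℝ) ≤ d - 1 := sub_nonneg.mpr (by exact_mod_cast hodd.pos)
  have hweight := projWeight_nonneg hodd.pos.ne' (posSemidef_of_mem_unitaryMixtures hσ)
  have h0 := hweight 0
  have h1 := hweight 1
  rw [tangentFunctional_apply]
  exact ⟨by positivity,
    div_le_one_of_le₀ (le_of_mem_unitaryMixtures_of_odd hodd hc hσ) (by positivity)⟩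

theorem tangentFunctional_planarState_zero_zero (hd : 2 ≤ d) (c : ℝ) :
    tangentFunctional d c (planarState d 0 0) = 0 := by
  rw [tangentFunctional_apply, projWeight_zero_planarState hd, projWeight_one_planarState hd,
    mul_zero, mul_zero, add_zero, mul_zero, zero_div]

theorem tangentFunctional_planarState_curve (hd : 2 ≤ d) {c : ℝ} (hc : 0 ≤ c) :
    tangentFunctional d c
      (planarState d ((1 + (d - 1) * c) ^ 2 / d ^ 2) ((d - 1) / d * (1 - c ^ 2))) = 1 := by
  have hd' : (0 : ℝ) < d - 1 := sub_pos.mpr (by exact_mod_cast hd)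
  have hd0 : (d : ℝ) ≠ 0 := by linarith
  rw [tangentFunctional_apply, projWeight_zero_planarState hd, projWeight_one_planarState hd,
    div_eq_one_iff_eq (by positivity)]
  field_simp
  ring

theorem tangentFunctional_zero_planarState (hd : 2 ≤ d) (x : ℝ) :
    tangentFunctional d 0 (planarState d x ((d - 1) / d)) = 1 := by
  have hd' : (0 : ℝ) < d - 1 := sub_pos.mpr (by exact_mod_cast hd)
  have hd0 : (d : ℝ) ≠ 0 := by linarith
  rw [tangentFunctional_apply, projWeight_one_planarState hd]
  field_simp
  ring

end SupportingLines

section Negativity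

variable {d : ℕ}

theorem zero_mem_negativeWeights {ρ : BipMat d} (hρ : ρ ∈ unitaryMixtures d) :
    (0 : ℝ) ∈ negativeWeights d ρ :=
  ⟨le_rfl, 1, zero_le_one, ρ, hρ, ρ, hρ, by rw [one_smul, zero_smul, sub_zero]⟩

theorem negativity_eq_zero {ρ : BipMat d} (hρ : ρ ∈ unitaryMixtures d) : negativity d ρ = 0 :=
  IsLeast.csInf_eq ⟨zero_mem_negativeWeights hρ, fun _ h => h.1⟩

theorem isLeast_negativeWeights_of_linearMap (hd : d ≠ 0) {σ τ : BipMat d}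
    (hσ : σ ∈ unitaryMixtures d) (hτ : τ ∈ unitaryMixtures d) {a : ℝ} (ha : 1 ≤ a)
    {W : BipMat d →ₗ[ℝ] ℝ} (hW : ∀ X ∈ unitaryMixtures d, W X ∈ Set.Icc 0 1)
    (hWσ : W σ = 1) (hWτ : W τ = 0) :
    IsLeast (negativeWeights d (a • σ + (1 - a) • τ)) (a - 1) := by
  refine ⟨⟨sub_nonneg.mpr ha, a, zero_le_one.trans ha, σ, hσ, τ, hτ, by module⟩, ?_⟩
  rintro b ⟨hb, p, hp, μ, hμ, ν, hν, hdecomp⟩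
  have weight_eq : p - b = 1 := by
    have h := congrArg (fun X => ∑ i, projWeight i X) hdecomp
    have hsum {X : BipMat d} (hX : X ∈ unitaryMixtures d) : ∑ i, projWeight i X = 1 :=
      sum_projWeight_of_mem_unitaryMixtures hd hX
    simp only [map_add, map_sub, map_smul, Finset.sum_add_distrib, Finset.sum_sub_distrib,
      smul_eq_mul, ← Finset.mul_sum, hsum hσ, hsum hτ, hsum hμ, hsum hν] at h
    linarith
  have value_eq : a = p * W μ - b * W ν := by
    simpa [hWσ, hWτ] using congrArg W hdecomp
  have hpμ : p * W μ ≤ p := mul_le_of_le_one_right hp (hW μ hμ).2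
  have hbν : 0 ≤ b * W ν := mul_nonneg hb (hW ν hν).1
  linarith

theorem isLeast_negativeWeights_planarState (hd : 2 ≤ d) (hodd : Odd d) {x y a c : ℝ}
    (hc : 0 ≤ c) (ha : 0 ≤ a) (hmem : planarState d x y ∈ unitaryMixtures d)
    (htangent : tangentFunctional d c (planarState d x y) = 1)
    (hρ : planarState d (a * x) (a * y) ∉ unitaryMixtures d) :
    IsLeast (negativeWeights d (planarState d (a * x) (a * y))) (a - 1) := by
  have origin_mem := planarState_zero_zero_mem_unitaryMixtures hd
  have ray_eq : planarState d (a * x) (a * y) =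
      a • planarState d x y + (1 - a) • planarState d 0 0 := by
    rw [planarState_smul_add_smul (by ring), mul_zero, add_zero, add_zero]
  have ha1 : 1 ≤ a := by
    by_contra! h
    exact hρ (ray_eq ▸ convex_unitaryMixtures hmem origin_mem ha (by linarith) (by ring))
  rw [ray_eq]
  exact isLeast_negativeWeights_of_linearMap (by omega) hmem origin_mem ha1
    (fun X hX => tangentFunctional_mem_Icc hodd hc hX) htangent
    (tangentFunctional_planarState_zero_zero hd c)

end Negativity

section TangentScale

/-- The reciprocal of the height `y` at which the ray `x = q * y` leaves the region of weights
`(x, y)` of mixtures of unitary channels in dimension `e`, when it does so on the curved part of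
the boundary. -/
noncomputable def tangentScale (e q : ℝ) : ℝ :=
  1 / (e - 2) * (e - 1 + (e + 2 / (e - 2)) * q -
    2 * ((e - 1) / (e - 2)) * √(q ^ 2 + (e - 2) / (e - 1) * q))

variable {e q : ℝ}

theorem exists_curve_parameter (he : 1 < e) (hq : 1 / (e * (e - 1)) ≤ q) :
    ∃ c ∈ Set.Ico (0 : ℝ) 1, q * (e * (e - 1) * (1 - c ^ 2)) = (1 + (e - 1) * c) ^ 2 := by
  have he1 : 0 < e - 1 := sub_pos.mpr he
  rw [div_le_iff₀ (by positivity)] at hq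
  have hcont : ContinuousOn
      (fun c => (1 + (e - 1) * c) ^ 2 - q * (e * (e - 1) * (1 - c ^ 2))) (Set.Icc 0 1) := by
    fun_prop
  obtain ⟨c, hc, hroot⟩ := intermediate_value_Ico zero_le_one hcont
    (show (0 : ℝ) ∈ Set.Ico _ _ from ⟨by linarith, by ring_nf; positivity⟩)
  exact ⟨c, hc, (sub_eq_zero.mp hroot).symm⟩

theorem tangentScale_eq (he : 2 < e) {c : ℝ} (hc : c ∈ Set.Ico (0 : ℝ) 1)
    (hcurve : q * (e * (e - 1) * (1 - c ^ 2)) = (1 + (e - 1) * c) ^ 2) :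
    tangentScale e q = e / ((e - 1) * (1 - c ^ 2)) := by
  have he1 : 0 < e - 1 := by linarith
  have he2 : 0 < e - 2 := by linarith
  have hc0 := hc.1
  have hcc : 0 < 1 - c ^ 2 := by nlinarith [hc.1, hc.2]
  obtain rfl : q = (1 + (e - 1) * c) ^ 2 / (e * (e - 1) * (1 - c ^ 2)) := by
    rw [eq_div_iff (by positivity), hcurve]
  set q := (1 + (e - 1) * c) ^ 2 / (e * (e - 1) * (1 - c ^ 2)) with hq
  have sqrt_eq : √(q ^ 2 + (e - 2) / (e - 1) * q) = (1 + c * (e - 1 + e * q)) / e := by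
    rw [Real.sqrt_eq_iff_eq_sq (by positivity) (by positivity), hq]
    field_simp
    ring
  rw [tangentScale, sqrt_eq, hq]
  field_simp
  ring

theorem tangentScale_lt (he : 2 < e) (hq : 1 / (e * (e - 1)) ≤ q) :
    tangentScale e q < e / (e - 1) * (1 + q) := by
  have he1 : 0 < e - 1 := by linarith
  obtain ⟨c, hc, hcurve⟩ := exists_curve_parameter (by linarith) hq
  have hc0 := hc.1
  have hcc : 0 < 1 - c ^ 2 := by nlinarith [hc.1, hc.2]
  have excess : (1 + (e - 1) * c) ^ 2 - e * (e - 1) * c ^ 2 = 1 + (e - 1) * (c * (2 - c)) := by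
    ring
  have excess_pos : 0 < 1 + (e - 1) * (c * (2 - c)) := by
    have : 0 ≤ 2 - c := by linarith [hc.2]
    positivity
  rw [tangentScale_eq he hc hcurve, div_mul_eq_mul_div, div_lt_div_iff₀ (by positivity) he1]
  nlinarith [excess, excess_pos]

end TangentScale

section CovariantNegativity

variable {d : ℕ} {q : Fin 3 → ℝ}

theorem planarState_mem_unitaryMixtures_of_le (hd : 3 ≤ d) (hodd : Odd d) {x : ℝ} (hx : 0 ≤ x)
    (hx' : x ≤ 1 / (d : ℝ) ^ 2) : planarState d x ((d - 1) / d) ∈ unitaryMixtures d := by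
  have hd' : (0 : ℝ) < d := by
    rw [Nat.cast_pos]
    omega
  have hxd : x * d ^ 2 ≤ 1 := by rwa [le_div_iff₀ (by positivity)] at hx'
  have h := convex_unitaryMixtures
    (planarState_curve_mem_unitaryMixtures hd hodd le_rfl zero_le_one)
    (planarState_zero_mem_unitaryMixtures hd hodd)
    (a := x * d ^ 2) (b := 1 - x * d ^ 2) (by positivity) (by linarith) (by ring)
  rw [planarState_smul_add_smul (by ring)] at h
  convert h using 2
  · field_simp
    ring
  · ring

theorem covariantState_one_pos_of_notMem (hd : 2 ≤ d) (hq : q ∈ stdSimplex ℝ (Fin 3))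
    (hρ : covariantState d q ∉ unitaryMixtures d) : 0 < q 1 := by
  refine lt_of_le_of_ne (hq.1 1) fun h => hρ ?_
  have hq0 : q 0 ≤ 1 := (mem_Icc_of_mem_stdSimplex hq 0).2
  have hmem := convex_unitaryMixtures (planarState_one_zero_mem_unitaryMixtures hd)
    (planarState_zero_zero_mem_unitaryMixtures hd) (hq.1 0) (sub_nonneg.mpr hq0) (by ring)
  rw [planarState_smul_add_smul (by ring)] at hmem
  rw [covariantState_eq_planarState hq.2, ← h]
  simpa using hmem

theorem isLeast_negativeWeights_of_le (hd : 3 ≤ d) (hodd : Odd d)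
    (hq : q ∈ stdSimplex ℝ (Fin 3)) (hρ : covariantState d q ∉ unitaryMixtures d)
    (h : q 0 / q 1 ≤ 1 / ((d : ℝ) * (d - 1))) :
    IsLeast (negativeWeights d (covariantState d q)) ((d : ℝ) / (d - 1) * q 1 - 1) := by
  have hd2 : 2 ≤ d := by omega
  have hq0 : 0 ≤ q 0 := hq.1 0
  have hq1 := covariantState_one_pos_of_notMem hd2 hq hρ
  have hd1 : (0 : ℝ) < d - 1 := sub_pos.mpr (by exact_mod_cast hd2)
  have hd0 : (0 : ℝ) < d := by linarith
  have hx : q 0 / q 1 * ((d - 1) / d) ≤ 1 / (d : ℝ) ^ 2 :=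
    calc q 0 / q 1 * ((d - 1) / d) ≤ 1 / ((d : ℝ) * (d - 1)) * ((d - 1) / d) := by gcongr
      _ = 1 / (d : ℝ) ^ 2 := by field_simp
  have touching := planarState_mem_unitaryMixtures_of_le hd hodd (by positivity) hx
  have state_eq : covariantState d q =
      planarState d (d / (d - 1) * q 1 * (q 0 / q 1 * ((d - 1) / d)))
        (d / (d - 1) * q 1 * ((d - 1) / d)) := by
    rw [covariantState_eq_planarState hq.2]
    congr 1 <;> field_simp
  rw [state_eq] at hρ ⊢
  exact isLeast_negativeWeights_planarState hd2 hodd le_rfl (by positivity) touching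
    (tangentFunctional_zero_planarState hd2 _) hρ

theorem isLeast_negativeWeights_of_lt (hd : 3 ≤ d) (hodd : Odd d)
    (hq : q ∈ stdSimplex ℝ (Fin 3)) (hρ : covariantState d q ∉ unitaryMixtures d)
    (h : 1 / ((d : ℝ) * (d - 1)) < q 0 / q 1) :
    IsLeast (negativeWeights d (covariantState d q)) (tangentScale d (q 0 / q 1) * q 1 - 1) := by
  have hd2 : 2 ≤ d := by omega
  have hq1 := covariantState_one_pos_of_notMem hd2 hq hρ
  have he : (2 : ℝ) < d := by exact_mod_cast hd
  have hd1 : (0 : ℝ) < d - 1 := by linarith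
  obtain ⟨c, hc, hcurve⟩ := exists_curve_parameter (by linarith) h.le
  have hcc : 0 < 1 - c ^ 2 := by nlinarith [hc.1, hc.2]
  rw [tangentScale_eq he hc hcurve]
  have state_eq : covariantState d q =
      planarState d (d / ((d - 1) * (1 - c ^ 2)) * q 1 * ((1 + (d - 1) * c) ^ 2 / d ^ 2))
        (d / ((d - 1) * (1 - c ^ 2)) * q 1 * ((d - 1) / d * (1 - c ^ 2))) := by
    rw [covariantState_eq_planarState hq.2, ← hcurve]
    congr 1 <;> field_simp
  rw [state_eq] at hρ ⊢
  exact isLeast_negativeWeights_planarState hd2 hodd hc.1 (by positivity)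
    (planarState_curve_mem_unitaryMixtures hd hodd hc.1 hc.2.le)
    (tangentFunctional_planarState_curve hd2 hc.1) hρ

theorem negativeWeights_nonempty (hd : 3 ≤ d) (hodd : Odd d) (hq : q ∈ stdSimplex ℝ (Fin 3)) :
    (negativeWeights d (covariantState d q)).Nonempty := by
  by_cases hρ : covariantState d q ∈ unitaryMixtures d
  · exact ⟨0, zero_mem_negativeWeights hρ⟩
  rcases le_or_gt (q 0 / q 1) (1 / ((d : ℝ) * (d - 1))) with h | h
  · exact (isLeast_negativeWeights_of_le hd hodd hq hρ h).nonempty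
  · exact (isLeast_negativeWeights_of_lt hd hodd hq hρ h).nonempty

theorem extremeState_eq_covariantState (d : ℕ) (i : Fin 3) :
    extremeState d i = covariantState d (Pi.single i 1) := by
  simp [covariantState, Pi.single_apply, ite_smul]

theorem extremeState_one_notMem_unitaryMixtures (hd : 2 ≤ d) (hodd : Odd d) :
    extremeState d 1 ∉ unitaryMixtures d := by
  intro h
  have hbound := le_of_mem_unitaryMixtures_of_odd hodd le_rfl h
  rw [extremeState_eq_covariantState, projWeight_covariantState hd, Pi.single_eq_same] at hbound
  linarith

theorem negativity_extremeState_one (hd : 3 ≤ d) (hodd : Odd d) :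
    negativity d (extremeState d 1) = 1 / ((d : ℝ) - 1) := by
  have hd1 : (0 : ℝ) < d - 1 := sub_pos.mpr (by exact_mod_cast (by omega : 1 < d))
  have hnotMem := extremeState_one_notMem_unitaryMixtures (by omega) hodd
  rw [extremeState_eq_covariantState] at hnotMem ⊢
  have hleast := isLeast_negativeWeights_of_le hd hodd (single_mem_stdSimplex ℝ 1) hnotMem
    (by rw [Pi.single_eq_of_ne (by decide), zero_div]; positivity)
  rw [negativity, hleast.csInf_eq, Pi.single_eq_same]
  field_simp
  ring

theorem lt_one_of_covariantState_ne (hq : q ∈ stdSimplex ℝ (Fin 3)) {i : Fin 3}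
    (hne : covariantState d q ≠ extremeState d i) : q i < 1 := by
  refine lt_of_le_of_ne (mem_Icc_of_mem_stdSimplex hq i).2 fun hi => hne ?_
  have hsum : ∑ j ∈ Finset.univ.erase i, q j = 0 := by
    linarith [hq.2, Finset.add_sum_erase Finset.univ q (Finset.mem_univ i)]
  rw [Finset.sum_eq_zero_iff_of_nonneg fun j _ => hq.1 j] at hsum
  rw [extremeState_eq_covariantState]
  congr 1
  ext j
  rcases eq_or_ne j i with rfl | hji
  · rw [hi, Pi.single_eq_same]
  · rw [hsum j (Finset.mem_erase.mpr ⟨hji, Finset.mem_univ j⟩), Pi.single_eq_of_ne hji]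

theorem negativity_lt_of_ne_extremeState_one (hd : 3 ≤ d) (hodd : Odd d)
    (hq : q ∈ stdSimplex ℝ (Fin 3)) (hne : covariantState d q ≠ extremeState d 1) :
    negativity d (covariantState d q) < 1 / ((d : ℝ) - 1) := by
  have he : (2 : ℝ) < d := by exact_mod_cast hd
  have hd1 : (0 : ℝ) < d - 1 := by linarith
  by_cases hρ : covariantState d q ∈ unitaryMixtures d
  · rw [negativity_eq_zero hρ]
    positivity
  have hq1 := covariantState_one_pos_of_notMem (by omega) hq hρ
  have top_eq : (d : ℝ) / (d - 1) * 1 - 1 = 1 / (d - 1) := by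
    field_simp
    ring
  rw [negativity, ← top_eq]
  rcases le_or_gt (q 0 / q 1) (1 / ((d : ℝ) * (d - 1))) with h | h
  · rw [(isLeast_negativeWeights_of_le hd hodd hq hρ h).csInf_eq]
    gcongr
    exact lt_one_of_covariantState_ne hq hne
  · rw [(isLeast_negativeWeights_of_lt hd hodd hq hρ h).csInf_eq]
    refine sub_lt_sub_right ?_ 1
    have hsum : q 0 + q 1 + q 2 = 1 := by rw [← Fin.sum_univ_three, hq.2]
    calc tangentScale d (q 0 / q 1) * q 1 < d / (d - 1) * (1 + q 0 / q 1) * q 1 := by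
          gcongr
          exact tangentScale_lt he h.le
      _ = d / (d - 1) * (q 1 + q 0) := by field_simp
      _ ≤ d / (d - 1) * 1 := by
          gcongr
          linarith [hq.1 2]

end CovariantNegativity

theorem mainTheorem9 (d : ℕ) (hd : 3 ≤ d) (hodd : Odd d) :
    -- every `O(d)`-covariant state in `𝒮` has unique coordinates `q`, and all `q` occur
    (∀ ρ ∈ unitalStates d ∩ orthogonalCommutant d,
      (∃! q : Fin 3 → ℝ, q ∈ stdSimplex ℝ (Fin 3) ∧ ρ = covariantState d q) ∧
      (negativeWeights d ρ).Nonempty) ∧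
    (∀ q ∈ stdSimplex ℝ (Fin 3),
      covariantState d q ∈ unitalStates d ∩ orthogonalCommutant d) ∧
    -- the closed form of the negativity outside `𝒰`
    (∀ q ∈ stdSimplex ℝ (Fin 3), covariantState d q ∉ unitaryMixtures d →
      0 < q 1 ∧
      (q 0 / q 1 ≤ 1 / ((d : ℝ) * (d - 1)) →
        negativity d (covariantState d q) = (d : ℝ) / (d - 1) * q 1 - 1) ∧
      (1 / ((d : ℝ) * (d - 1)) < q 0 / q 1 →
        negativity d (covariantState d q) =
          1 / ((d : ℝ) - 2) *
            ((d : ℝ) - 1 + ((d : ℝ) + 2 / ((d : ℝ) - 2)) * (q 0 / q 1)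
              - 2 * (((d : ℝ) - 1) / ((d : ℝ) - 2)) *
                Real.sqrt ((q 0 / q 1) ^ 2 + ((d : ℝ) - 2) / ((d : ℝ) - 1) * (q 0 / q 1)))
            * q 1 - 1)) ∧
    -- the maximum is attained exactly at the Werner–Holevo channel
    jamiolkowski (wernerHolevo d) = extremeState d 1 ∧
    jamiolkowski (wernerHolevo d) ∈
      (unitalStates d ∩ orthogonalCommutant d) \ unitaryMixtures d ∧
    (∀ ρ ∈ unitalStates d ∩ orthogonalCommutant d,
      negativity d ρ ≤ 1 / ((d : ℝ) - 1) ∧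
      (negativity d ρ = 1 / ((d : ℝ) - 1) ↔ ρ = jamiolkowski (wernerHolevo d))) := by
  have hd2 : 2 ≤ d := by omega
  have hmem {q : Fin 3 → ℝ} (hq : q ∈ stdSimplex ℝ (Fin 3)) :
      covariantState d q ∈ unitalStates d ∩ orthogonalCommutant d :=
    ⟨covariantState_mem_unitalStates hd2 hq, covariantState_mem_orthogonalCommutant q⟩
  refine ⟨fun ρ hρ => ?_, fun q hq => hmem hq, fun q hq hρ =>
    ⟨covariantState_one_pos_of_notMem hd2 hq hρ,
      fun h => (isLeast_negativeWeights_of_le hd hodd hq hρ h).csInf_eq,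
      fun h => (isLeast_negativeWeights_of_lt hd hodd hq hρ h).csInf_eq⟩,
    jamiolkowski_wernerHolevo hd2, ?_, fun ρ hρ => ?_⟩
  · obtain ⟨q, hq, rfl⟩ := exists_eq_covariantState_of_mem_unitalStates hd2 hρ
    exact ⟨⟨q, ⟨hq, rfl⟩, fun q' h => (covariantState_injective hd2 h.2).symm⟩,
      negativeWeights_nonempty hd hodd hq⟩
  · rw [jamiolkowski_wernerHolevo hd2]
    refine ⟨?_, extremeState_one_notMem_unitaryMixtures hd2 hodd⟩
    exact extremeState_eq_covariantState d 1 ▸ hmem (single_mem_stdSimplex ℝ 1)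
  · rw [jamiolkowski_wernerHolevo hd2]
    obtain ⟨q, hq, rfl⟩ := exists_eq_covariantState_of_mem_unitalStates hd2 hρ
    rcases eq_or_ne (covariantState d q) (extremeState d 1) with h | h
    · simp only [h, negativity_extremeState_one hd hodd, le_refl, true_and]
    · have hlt := negativity_lt_of_ne_extremeState_one hd hodd hq h
      exact ⟨hlt.le, fun heq => absurd heq hlt.ne, fun heq => absurd heq h⟩
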